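/- **Setting.** Let $n\ge 1$, $m\ge 0$, let $Q\in\mathbb R^{n\times n}$ be diagonal and positive semidefinite, $A\in\mathbb R^{m\times n}$, $b\in\mathbb R^m$, $c\in\mathbb R^n$, and consider the pair (P) $\min_x \tfrac12x^TQx+c^Tx$ s.t. $Ax=b$, $x\ge0$, and (D) $\max_{x,y,z} b^Ty-\tfrac12x^TQx$ s.t. $A^Ty+z=Qx+c$, $z\ge0$. Define the seminorm $\|(p,q)\|_{\mathcal A}=\min\{\|(x,z)\|_2 : Ax=p,\ -Qx+A^Ty+z=q\}$. **Algorithm (inexact IP-PMM with $\rho_k=\delta_k=\mu_k$).** Fix parameters $0<\sigma_{\min}\le\sigma_{\max}\le 0.5$, $C_N>0$, $\gamma_{\mathcal A},\gamma_\mu\in(0,1)$, $\rho>0$. Start from $x^0=z^0=\rho\mathbf 1_n$, an arbitrary $y^0$, $\zeta^0=x^0$, $\lambda^0=y^0$, and let $\bar b=Ax^0-b$, $\bar c=-Qx^0+A^Ty^0+z^0-c$. Throughout $\mu_k=(x^k)^Tz^k/n$. The neighborhood $\mathcal N_\mu(\zeta,\lambda)$ is the set of $(x,y,z)$ with $x,z>0$,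 $x_iz_i\ge\gamma_\mu\mu$ for all $i$, and $$Ax+\mu(y-\lambda)=b+\tfrac{\mu}{\mu_0}(\bar b+\tilde b),\qquad -Qx+A^Ty+z-\mu(x-\zeta)=c+\tfrac{\mu}{\mu_0}(\bar c+\tilde c)$$ for some $\tilde b,\tilde c$ with $\|(\tilde b,\tilde c)\|_2\le C_N$, $\|(\tilde b,\tilde c)\|_{\mathcal A}\le\gamma_{\mathcal A}\rho$. Iteration $k$ chooses $\sigma_k\in[\sigma_{\min},\sigma_{\max}]$ and a direction $(\Delta x^k,\Delta y^k,\Delta z^k)$ with $$\begin{aligned} -(Q+\mu_kI)\Delta x^k+A^T\Delta y^k+\Delta z^k&=-\big[-(c+\tfrac{\sigma_k\mu_k}{\mu_0}\bar c)-Qx^k+A^Ty^k+z^k-\sigma_k\mu_k(x^k-\zeta^k)\big]+\varrho_d^k,\\ A\Delta x^k+\mu_k\Delta y^k&=-\big[Ax^k+\sigma_k\mu_k(y^k-\lambda^k)-(b+\tfrac{\sigma_k\mu_k}{\mu_0}\bar b)\big]+\varrho_p^k,\\ z^k_i\Delta x^k_i+x^k_i\Delta z^k_i&=-\big[x^k_iz^k_i-\sigma_k\mu_k\big]+(\varrho_\mu^k)_i\quad(1\le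 i\le n). \end{aligned}$$ A stepsize $\alpha\in(0,1]$ is *admissible* for this direction if, with $(x(\alpha),y(\alpha),z(\alpha))=(x^k,y^k,z^k)+\alpha(\Delta x^k,\Delta y^k,\Delta z^k)$ and $\mu_k(\alpha)=x(\alpha)^Tz(\alpha)/n$, one has $\mu_k(\alpha)\le(1-0.01\alpha)\mu_k$ and $(x(\alpha),y(\alpha),z(\alpha))\in\mathcal N_{\mu_k(\alpha)}(\zeta^k,\lambda^k)$. The algorithm takes the largest admissible stepsize $\alpha_k$ and sets $(x^{k+1},y^{k+1},z^{k+1})=(x(\alpha_k),y(\alpha_k),z(\alpha_k))$. With $\tilde r_p=Ax^{k+1}-b-\tfrac{\mu_{k+1}}{\mu_0}\bar b$ and $\tilde r_d=-Qx^{k+1}+A^Ty^{k+1}+z^{k+1}-c-\tfrac{\mu_{k+1}}{\mu_0}\bar c$, it sets $(\zeta^{k+1},\lambda^{k+1})=(x^{k+1},y^{k+1})$ if $\|(\tilde r_p,\tilde r_d)\|_2\le C_N\mu_{k+1}/\mu_0$ and $\|(\tilde r_p,\tilde r_d)\|_{\mathcal A}\le\gamma_{\mathcal A}\rho\,\mu_{k+1}/\mu_0$,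 and $(\zeta^{k+1},\lambda^{k+1})=(\zeta^k,\lambda^k)$ otherwise. **Assumptions.** 1. At each iteration $\varrho_\mu^k=0$, $\|(\varrho_p^k,\varrho_d^k)\|_2\le\frac{\sigma_{\min}}{4\mu_0}C_N\mu_k$ and $\|(\varrho_p^k,\varrho_d^k)\|_{\mathcal A}\le\frac{\sigma_{\min}}{4\mu_0}\gamma_{\mathcal A}\rho\,\mu_k$. 2. There are $x^*,y^*,z^*$ such that $x^*$ is optimal for (P), $(x^*,y^*,z^*)$ is optimal for (D), and $\|x^*\|_\infty,\|y^*\|_\infty,\|z^*\|_\infty\le C^*$. 3. $\operatorname{rank}A=m$, the $m$ singular values of $A$ lie in $[C_{\min},C_{\max}]$, the eigenvalues of $Q$ are at most $C_Q$, and $\|(c,b)\|_\infty\le C_r$. Moreover $\|y^0\|_\infty\le C_y$. Here $C^*,C_y\ge0$ and $C_{\min},C_{\max},C_Q,C_r>0$. **Theorem.** There is a constant $\bar\kappa>0$, depending only on $\sigma_{\min},\sigma_{\max},C_N,\gamma_{\mathcal A},\gamma_\mu,\rho,C^*,C_{\min},C_{\max},C_Q,C_r,C_y$ (in particular independent of $n$,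 $m$, $k$ and $\epsilon$), such that for all data satisfying Assumptions 2 and 3 and all iterates generated by inexact IP-PMM under Assumption 1 the following holds. (a) At every iteration $k$, and for every direction allowed there, every $\alpha\in(0,\bar\kappa/n^4]$ is an admissible stepsize. (b) Let $\epsilon\in(0,1)$ and let $C,\omega>0$ be such that $\mu_0\le C/\epsilon^{\omega}$. Then $\mu_k\le\epsilon$ for every iteration index $$k\ \ge\ \frac{n^4}{0.01\,\bar\kappa}\Big[(1+\omega)\log\tfrac1\epsilon+\log C\Big].$$ (c) For fixed $C,\omega>0$, the bound in (b) is $O\big(n^4\log\frac1\epsilon\big)$ as $\epsilon\to0^+$, uniformly in $n$. -/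

import Mathlib

open Filter Topology Asymptotics Matrix

namespace IPPMM

/-- Data of the quadratic program pair
(P) minimize `½ xᵀQx + cᵀx` subject to `Ax = b`, `x ≥ 0`;
(D) maximize `bᵀy - ½ xᵀQx` subject to `Aᵀy + z = Qx + c`, `z ≥ 0`. -/
structure QP (n m : ℕ) where
  Q : Matrix (Fin n) (Fin n) ℝ
  A : Matrix (Fin m) (Fin n) ℝ
  b : Fin m → ℝ
  c : Fin n → ℝ

namespace QP

variable {n m : ℕ} (P : QP n m)

/-- The problem is convex and separable: `Q` is diagonal and positive semidefinite. -/
def SeparableConvex : Prop := P.Q.IsDiag ∧ P.Q.PosSemidef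

noncomputable def primalObj (x : Fin n → ℝ) : ℝ := (1 / 2) * (x ⬝ᵥ P.Q *ᵥ x) + P.c ⬝ᵥ x

noncomputable def dualObj (x : Fin n → ℝ) (y : Fin m → ℝ) : ℝ :=
  P.b ⬝ᵥ y - (1 / 2) * (x ⬝ᵥ P.Q *ᵥ x)

def PrimalFeasible (x : Fin n → ℝ) : Prop := P.A *ᵥ x = P.b ∧ 0 ≤ x

def DualFeasible (x : Fin n → ℝ) (y : Fin m → ℝ) (z : Fin n → ℝ) : Prop :=
  P.Aᵀ *ᵥ y + z = P.Q *ᵥ x + P.c ∧ 0 ≤ z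

/-- `(x, y, z)` is an optimal solution of the pair: `x` is optimal for (P) and `(x, y, z)` is
optimal for (D). -/
def IsOptimal (x : Fin n → ℝ) (y : Fin m → ℝ) (z : Fin n → ℝ) : Prop :=
  (P.PrimalFeasible x ∧ ∀ x', P.PrimalFeasible x' → P.primalObj x ≤ P.primalObj x') ∧
  (P.DualFeasible x y z ∧ ∀ x' y' z', P.DualFeasible x' y' z' → P.dualObj x' y' ≤ P.dualObj x y)

/-- The pair has an optimal solution that is bounded by `Cstar` in the maximum norm (which is the
norm `‖·‖` of the function space `Fin n → ℝ`). -/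
def BoundedOptimalSolution (Cstar : ℝ) : Prop :=
  ∃ (x : Fin n → ℝ) (y : Fin m → ℝ) (z : Fin n → ℝ),
    P.IsOptimal x y z ∧ ‖x‖ ≤ Cstar ∧ ‖y‖ ≤ Cstar ∧ ‖z‖ ≤ Cstar

/-- `A` has full row rank, its `m` singular values lie in `[Cmin, Cmax]` (`singularValues` lists
the singular values in decreasing order and continues with zeros), the eigenvalues of `Q` are at
most `CQ`, and the entries of `c` and `b` are at most `Cr` in absolute value. -/
def RegularData (Cmin Cmax CQ Cr : ℝ) : Prop :=
  P.A.rank = m ∧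
  (∀ i < m, Cmin ≤ (Matrix.toEuclideanLin P.A).singularValues i ∧
    (Matrix.toEuclideanLin P.A).singularValues i ≤ Cmax) ∧
  (∀ t ∈ spectrum ℝ P.Q, t ≤ CQ) ∧ ‖P.c‖ ≤ Cr ∧ ‖P.b‖ ≤ Cr

end QP

/-- The Euclidean norm of the stacked vector `(u, v)`. -/
noncomputable def pairNorm {p q : ℕ} (u : Fin p → ℝ) (v : Fin q → ℝ) : ℝ :=
  Real.sqrt (u ⬝ᵥ u + v ⬝ᵥ v)

/-- The seminorm `‖(b, c)‖_𝒜`: the least Euclidean norm of `(x, z)` over all `(x, y, z)` with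
`Ax = b` and `-Qx + Aᵀy + z = c`. -/
noncomputable def semiNorm {n m : ℕ} (P : QP n m) (b : Fin m → ℝ) (c : Fin n → ℝ) : ℝ :=
  sInf {t : ℝ | ∃ (x : Fin n → ℝ) (y : Fin m → ℝ) (z : Fin n → ℝ),
    P.A *ᵥ x = b ∧ -(P.Q *ᵥ x) + P.Aᵀ *ᵥ y + z = c ∧ t = pairNorm x z}

/-- The parameters of the algorithm, together with the size `ρ` of the starting point. -/
structure Params where
  σmin : ℝ
  σmax : ℝ
  CN : ℝ
  γA : ℝ
  γμ : ℝ
  ρ : ℝ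

def Params.Valid (par : Params) : Prop :=
  (0 < par.σmin ∧ par.σmin ≤ par.σmax ∧ par.σmax ≤ 1 / 2) ∧ 0 < par.CN ∧
  (0 < par.γA ∧ par.γA < 1) ∧ (0 < par.γμ ∧ par.γμ < 1) ∧ 0 < par.ρ

/-- A primal-dual triple `(x, y, z)`. -/
structure Triple (n m : ℕ) where
  x : Fin n → ℝ
  y : Fin m → ℝ
  z : Fin n → ℝ

namespace Triple

variable {n m : ℕ}

/-- The duality measure `xᵀz / n`. -/
noncomputable def mu (w : Triple n m) : ℝ := (w.x ⬝ᵥ w.z) / n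

/-- The point `w + α d`. -/
def move (w : Triple n m) (α : ℝ) (d : Triple n m) : Triple n m :=
  ⟨w.x + α • d.x, w.y + α • d.y, w.z + α • d.z⟩

end Triple

/-- The current iterate with the current estimates `ζ` of the primal solution and `lam` of the
multiplier. -/
structure State (n m : ℕ) where
  pt : Triple n m
  ζ : Fin n → ℝ
  lam : Fin m → ℝ

/-- A problem, the parameters, and the free part `y0` of the starting point. -/
structure Instance (n m : ℕ) where
  P : QP n m
  par : Params
  y0 : Fin m → ℝ

namespace Instance

variable {n m : ℕ} (I : Instance n m)

/-- The starting point: `x⁰ = z⁰ = ρ (1, …, 1)`, with the given `y⁰`. -/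
def start : Triple n m := ⟨fun _ => I.par.ρ, I.y0, fun _ => I.par.ρ⟩

noncomputable def mu0 : ℝ := I.start.mu

/-- `b̄`, given by `A x⁰ = b + b̄`. -/
def bbar : Fin m → ℝ := I.P.A *ᵥ I.start.x - I.P.b

/-- `c̄`, given by `-Q x⁰ + Aᵀ y⁰ + z⁰ = c + c̄`. -/
def cbar : Fin n → ℝ := -(I.P.Q *ᵥ I.start.x) + I.P.Aᵀ *ᵥ I.start.y + I.start.z - I.P.c

/-- The neighborhood `𝒩_μ(ζ, lam)`. -/
def nbhd (μ : ℝ) (ζ : Fin n → ℝ) (lam : Fin m → ℝ) : Set (Triple n m) :=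
  {w | (∃ (bt : Fin m → ℝ) (ct : Fin n → ℝ),
      I.P.A *ᵥ w.x + μ • (w.y - lam) = I.P.b + (μ / I.mu0) • (I.bbar + bt) ∧
      -(I.P.Q *ᵥ w.x) + I.P.Aᵀ *ᵥ w.y + w.z - μ • (w.x - ζ)
        = I.P.c + (μ / I.mu0) • (I.cbar + ct) ∧
      pairNorm bt ct ≤ I.par.CN ∧ semiNorm I.P bt ct ≤ I.par.γA * I.par.ρ) ∧
    ∀ i, 0 < w.x i ∧ 0 < w.z i ∧ I.par.γμ * μ ≤ w.x i * w.z i}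

/-- `d` solves the Newton system at the state `s` with centering parameter `σ` and residuals
`(rd, rp, rμ)`. The regularization parameters are `ρ_k = δ_k = μ_k`. -/
def Newton (s : State n m) (σ : ℝ) (d : Triple n m)
    (rd : Fin n → ℝ) (rp : Fin m → ℝ) (rμ : Fin n → ℝ) : Prop :=
  -(I.P.Q *ᵥ d.x + s.pt.mu • d.x) + I.P.Aᵀ *ᵥ d.y + d.z
    = -(-(I.P.c + (σ * s.pt.mu / I.mu0) • I.cbar) - I.P.Q *ᵥ s.pt.x + I.P.Aᵀ *ᵥ s.pt.y + s.pt.z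
        - (σ * s.pt.mu) • (s.pt.x - s.ζ)) + rd ∧
  I.P.A *ᵥ d.x + s.pt.mu • d.y
    = -(I.P.A *ᵥ s.pt.x + (σ * s.pt.mu) • (s.pt.y - s.lam)
        - (I.P.b + (σ * s.pt.mu / I.mu0) • I.bbar)) + rp ∧
  s.pt.z * d.x + s.pt.x * d.z = -(s.pt.x * s.pt.z - fun _ => σ * s.pt.mu) + rμ

/-- The bounds that the residuals of the Newton system have to satisfy at the state `s`. -/
def ResidualBound (s : State n m) (rd : Fin n → ℝ) (rp : Fin m → ℝ) (rμ : Fin n → ℝ) : Prop :=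
  rμ = 0 ∧
  pairNorm rp rd ≤ I.par.σmin / (4 * I.mu0) * I.par.CN * s.pt.mu ∧
  semiNorm I.P rp rd ≤ I.par.σmin / (4 * I.mu0) * I.par.γA * I.par.ρ * s.pt.mu

/-- `d` is a search direction that the algorithm may use at the state `s`. -/
def IsDirection (s : State n m) (d : Triple n m) : Prop :=
  ∃ (σ : ℝ) (rd : Fin n → ℝ) (rp : Fin m → ℝ) (rμ : Fin n → ℝ),
    I.par.σmin ≤ σ ∧ σ ≤ I.par.σmax ∧ I.Newton s σ d rd rp rμ ∧ I.ResidualBound s rd rp rμ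

/-- The stepsizes among which the algorithm takes the largest. -/
def admissible (s : State n m) (d : Triple n m) : Set ℝ :=
  {α | 0 < α ∧ α ≤ 1 ∧ (s.pt.move α d).mu ≤ (1 - 0.01 * α) * s.pt.mu ∧
    s.pt.move α d ∈ I.nbhd (s.pt.move α d).mu s.ζ s.lam}

/-- The test for updating the estimates at the new iterate `w`. The residuals carry the signs of
the two equations that define the seminorm and the neighborhood. -/
def UpdateTest (w : Triple n m) : Prop :=
  let rp : Fin m → ℝ := I.P.A *ᵥ w.x - I.P.b - (w.mu / I.mu0) • I.bbar
  let rd : Fin n → ℝ :=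
    -(I.P.Q *ᵥ w.x) + I.P.Aᵀ *ᵥ w.y + w.z - I.P.c - (w.mu / I.mu0) • I.cbar
  pairNorm rp rd ≤ I.par.CN * (w.mu / I.mu0) ∧
  semiNorm I.P rp rd ≤ I.par.γA * I.par.ρ * (w.mu / I.mu0)

/-- One iteration of inexact IP-PMM leads from `s` to `s'`. -/
def Step (s s' : State n m) : Prop :=
  ∃ (d : Triple n m) (α : ℝ), I.IsDirection s d ∧ IsGreatest (I.admissible s d) α ∧
    s'.pt = s.pt.move α d ∧
    (I.UpdateTest s'.pt → s'.ζ = s'.pt.x ∧ s'.lam = s'.pt.y) ∧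
    (¬ I.UpdateTest s'.pt → s'.ζ = s.ζ ∧ s'.lam = s.lam)

/-- `s 0, …, s N` are produced by `N` iterations of inexact IP-PMM. A run that stops early, or does
not stop at all, is covered through its initial segments. -/
def Run (N : ℕ) (s : ℕ → State n m) : Prop :=
  s 0 = ⟨I.start, I.start.x, I.start.y⟩ ∧ ∀ k < N, I.Step (s k) (s (k + 1))

end Instance

/-- The number `n⁴ / (0.01 κ) · ((1 + ω) log (1/ε) + log C)`. -/
noncomputable def iterationBound (κ C ω : ℝ) (n : ℕ) (ε : ℝ) : ℝ :=
  (n : ℝ) ^ 4 / (0.01 * κ) * ((1 + ω) * Real.log (1 / ε) + Real.log C)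

end IPPMM

/-! The linear map `(x, y, z) ↦ (Ax, -Qx + Aᵀy + z)` is monotone up to the complementarity term: its
scalar product with `(y, -x)` is `xᵀQx - xᵀz ≥ -xᵀz`. The points of a neighborhood at level
`θ = μ / μ₀` solve a perturbed linear system, and the same system is solved by a reference point,
namely the convex combination, with weights `θ` and `1 - θ`, of a shift of the starting point and a
complementary solution. The entries of the shifted starting point stay of order `1` because the
perturbations have seminorm at most `γ_𝒜 ρ` with `γ_𝒜 < 1`, so the entries of the reference point
are at least of order `θ`. Monotonicity for the difference of the two then bounds the iterates by
`O(n)`, and the estimates `(ζ, λ)` likewise.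

For the Newton direction, monotonicity makes `Δx` and `Δz` nearly orthogonal once scaled by
`√(z / x)` and `√(x / z)`, whence `|Δxᵢ Δzᵢ| = O(n⁴ μ)`. For `α ≤ κ / n⁴` the second-order terms,
which carry a factor `α²`, are therefore absorbed by the first-order progress, which is of order
`α σ_min`. Every such step is admissible, and so the largest one multiplies `μ` by at most
`1 - 0.01 κ / n⁴`. -/

namespace IPPMM

section l2Norm

variable {ι κ : Type*} [Fintype ι] [Fintype κ]

/-- The Euclidean norm of a coordinate vector. The norm `‖u‖` of the function space is the maximum
norm. -/
noncomputable def l2Norm (u : ι → ℝ) : ℝ := ‖WithLp.toLp 2 u‖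

lemma l2Norm_nonneg (u : ι → ℝ) : 0 ≤ l2Norm u := norm_nonneg _

@[simp] lemma l2Norm_zero : l2Norm (0 : ι → ℝ) = 0 := by simp [l2Norm]

lemma l2Norm_sq (u : ι → ℝ) : l2Norm u ^ 2 = u ⬝ᵥ u := by
  rw [l2Norm, EuclideanSpace.norm_sq_eq]
  simp [dotProduct, sq]

lemma l2Norm_add_le (u v : ι → ℝ) : l2Norm (u + v) ≤ l2Norm u + l2Norm v := norm_add_le _ _

lemma l2Norm_sub_le (u v : ι → ℝ) : l2Norm (u - v) ≤ l2Norm u + l2Norm v := norm_sub_le _ _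

lemma l2Norm_neg (u : ι → ℝ) : l2Norm (-u) = l2Norm u := norm_neg (WithLp.toLp 2 u)

lemma l2Norm_smul (a : ℝ) (u : ι → ℝ) : l2Norm (a • u) = |a| * l2Norm u :=
  norm_smul a (WithLp.toLp 2 u)

lemma dotProduct_le_l2Norm_mul (u v : ι → ℝ) : u ⬝ᵥ v ≤ l2Norm u * l2Norm v := by
  have h := real_inner_le_norm (WithLp.toLp 2 v) (WithLp.toLp 2 u)
  rw [EuclideanSpace.inner_toLp_toLp] at h
  simpa [l2Norm, mul_comm] using h

lemma abs_apply_le_l2Norm (u : ι → ℝ) (i : ι) : |u i| ≤ l2Norm u :=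
  PiLp.norm_apply_le (WithLp.toLp 2 u) i

lemma sq_apply_le_l2Norm_sq (u : ι → ℝ) (i : ι) : u i ^ 2 ≤ l2Norm u ^ 2 :=
  sq_le_sq.2 ((abs_apply_le_l2Norm u i).trans (le_abs_self _))

lemma l2Norm_le_mul_l2Norm {u v : ι → ℝ} {C : ℝ} (hC : 0 ≤ C) (h : ∀ i, |u i| ≤ C * |v i|) :
    l2Norm u ≤ C * l2Norm v := by
  refine le_of_sq_le_sq ?_ (mul_nonneg hC (l2Norm_nonneg v))
  rw [mul_pow, l2Norm_sq, l2Norm_sq, dotProduct, dotProduct, Finset.mul_sum]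
  refine Finset.sum_le_sum fun i _ => ?_
  simpa only [← sq, sq_abs, mul_pow] using pow_le_pow_left₀ (abs_nonneg _) (h i) 2

lemma l2Norm_le_sum {u : ι → ℝ} (h : ∀ i, 0 ≤ u i) : l2Norm u ≤ ∑ i, u i := by
  refine le_of_sq_le_sq ?_ (Finset.sum_nonneg fun i _ => h i)
  rw [l2Norm_sq, sq, dotProduct, Finset.sum_mul_sum]
  exact Finset.sum_le_sum fun i _ => Finset.single_le_sum (f := fun j => u i * u j)
    (fun j _ => mul_nonneg (h i) (h j)) (Finset.mem_univ i)

lemma l2Norm_le_mul_of_abs_le {u : ι → ℝ} {C : ℝ} {N : ℕ} (hN : Fintype.card ι ≤ N) (hC : 0 ≤ C)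
    (h : ∀ i, |u i| ≤ C) : l2Norm u ≤ C * N := by
  have hsum : l2Norm (fun _ : ι => (1 : ℝ)) ≤ N :=
    (l2Norm_le_sum fun _ => zero_le_one).trans (by simpa using hN)
  exact (l2Norm_le_mul_l2Norm hC fun i => by simpa using h i).trans
    (mul_le_mul_of_nonneg_left hsum hC)

lemma l2Norm_sq_sumElim (u : ι → ℝ) (v : κ → ℝ) :
    l2Norm (Sum.elim u v) ^ 2 = l2Norm u ^ 2 + l2Norm v ^ 2 := by
  simp [l2Norm_sq, dotProduct]

lemma l2Norm_sumElim_le (u : ι → ℝ) (v : κ → ℝ) : l2Norm (Sum.elim u v) ≤ l2Norm u + l2Norm v := by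
  have hu := l2Norm_nonneg u
  have hv := l2Norm_nonneg v
  refine le_of_sq_le_sq ?_ (add_nonneg hu hv)
  rw [l2Norm_sq_sumElim]
  nlinarith

lemma l2Norm_comp_inl_le (r : ι ⊕ κ → ℝ) : l2Norm (r ∘ Sum.inl) ≤ l2Norm r := by
  refine le_of_sq_le_sq ?_ (l2Norm_nonneg r)
  rw [← Sum.elim_comp_inl_inr r, l2Norm_sq_sumElim]
  exact le_add_of_nonneg_right (sq_nonneg _)

lemma l2Norm_comp_inr_le (r : ι ⊕ κ → ℝ) : l2Norm (r ∘ Sum.inr) ≤ l2Norm r := by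
  refine le_of_sq_le_sq ?_ (l2Norm_nonneg r)
  rw [← Sum.elim_comp_inl_inr r, l2Norm_sq_sumElim]
  exact le_add_of_nonneg_left (sq_nonneg _)

lemma l2Norm_le_of_forall_dotProduct_le {u : ι → ℝ} {C : ℝ} (hC : 0 ≤ C)
    (h : ∀ v, u ⬝ᵥ v ≤ C * l2Norm v) : l2Norm u ≤ C := by
  rcases (l2Norm_nonneg u).eq_or_lt' with h0 | hpos
  · exact h0.trans_le hC
  · refine le_of_mul_le_mul_right ?_ hpos
    rw [← sq, l2Norm_sq]
    exact h u

lemma l2Norm_transpose_mulVec_le {A : Matrix ι κ ℝ} {C : ℝ} (hC : 0 ≤ C)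
    (h : ∀ x, l2Norm (A *ᵥ x) ≤ C * l2Norm x) (y : ι → ℝ) : l2Norm (Aᵀ *ᵥ y) ≤ C * l2Norm y := by
  refine l2Norm_le_of_forall_dotProduct_le (mul_nonneg hC (l2Norm_nonneg y)) fun x => ?_
  calc (Aᵀ *ᵥ y) ⬝ᵥ x = y ⬝ᵥ A *ᵥ x := by rw [mulVec_transpose, ← dotProduct_mulVec]
    _ ≤ l2Norm y * l2Norm (A *ᵥ x) := dotProduct_le_l2Norm_mul _ _
    _ ≤ l2Norm y * (C * l2Norm x) := mul_le_mul_of_nonneg_left (h x) (l2Norm_nonneg y)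
    _ = C * l2Norm y * l2Norm x := by ring

lemma l2Norm_le_of_exists_mulVec_eq {A : Matrix ι κ ℝ} {C : ℝ} (hC : 0 ≤ C)
    (h : ∀ b, ∃ x, A *ᵥ x = b ∧ l2Norm x ≤ C * l2Norm b) (y : ι → ℝ) :
    l2Norm y ≤ C * l2Norm (Aᵀ *ᵥ y) := by
  have hy := l2Norm_nonneg (Aᵀ *ᵥ y)
  refine l2Norm_le_of_forall_dotProduct_le (mul_nonneg hC hy) fun b => ?_
  obtain ⟨x, rfl, hx⟩ := h b
  calc y ⬝ᵥ A *ᵥ x = (Aᵀ *ᵥ y) ⬝ᵥ x := by rw [mulVec_transpose, ← dotProduct_mulVec]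
    _ ≤ l2Norm (Aᵀ *ᵥ y) * l2Norm x := dotProduct_le_l2Norm_mul _ _
    _ ≤ l2Norm (Aᵀ *ᵥ y) * (C * l2Norm (A *ᵥ x)) := mul_le_mul_of_nonneg_left hx hy
    _ = C * l2Norm (Aᵀ *ᵥ y) * l2Norm (A *ᵥ x) := by ring

end l2Norm

section Spectral

variable {E F : Type*} [NormedAddCommGroup E] [InnerProductSpace ℝ E] [FiniteDimensional ℝ E]
  [NormedAddCommGroup F] [InnerProductSpace ℝ F] [FiniteDimensional ℝ F] (T : E →ₗ[ℝ] F)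

lemma norm_sq_apply_eq_sum_singularValues (x : E) :
    ‖T x‖ ^ 2 = ∑ i : Fin (Module.finrank ℝ E), T.singularValues i ^ 2 *
      (T.isSymmetric_adjoint_comp_self.eigenvectorBasis rfl).repr x i ^ 2 := by
  set hT := T.isSymmetric_adjoint_comp_self
  set e := hT.eigenvectorBasis rfl
  have h1 : ‖T x‖ ^ 2 = inner ℝ x ((LinearMap.adjoint T ∘ₗ T) x) := by
    rw [LinearMap.comp_apply, LinearMap.adjoint_inner_right, real_inner_self_eq_norm_sq]
  rw [h1, ← e.repr.inner_map_map, PiLp.inner_apply]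
  refine Finset.sum_congr rfl fun i _ => ?_
  rw [hT.eigenvectorBasis_apply_self_apply rfl x i, T.sq_singularValues_fin rfl]
  simp only [RCLike.inner_apply, conj_trivial, RCLike.ofReal_real_eq_id, id]
  ring

lemma norm_apply_le_of_singularValues_le {C : ℝ} (hC : 0 ≤ C)
    (h : ∀ i < Module.finrank ℝ T.range, T.singularValues i ≤ C) (x : E) : ‖T x‖ ≤ C * ‖x‖ := by
  set e := T.isSymmetric_adjoint_comp_self.eigenvectorBasis rfl
  refine le_of_sq_le_sq ?_ (by positivity)
  rw [norm_sq_apply_eq_sum_singularValues, mul_pow, ← e.repr.norm_map x, EuclideanSpace.norm_sq_eq,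
    Finset.mul_sum]
  refine Finset.sum_le_sum fun i _ => ?_
  rw [Real.norm_eq_abs, sq_abs]
  gcongr
  · exact T.singularValues_nonneg _
  · by_cases hi : (i : ℕ) < Module.finrank ℝ T.range
    · exact h i hi
    · rw [T.singularValues_eq_zero_iff_le_finrank_range.2 (not_lt.1 hi)]
      exact hC

lemma exists_preimage_norm_le_of_le_singularValues {C : ℝ} (hC : 0 < C)
    (h : ∀ i < Module.finrank ℝ T.range, C ≤ T.singularValues i) (x : E) :
    ∃ x', T x' = T x ∧ C * ‖x'‖ ≤ ‖T x‖ := by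
  set e := T.isSymmetric_adjoint_comp_self.eigenvectorBasis rfl with he
  set r := Module.finrank ℝ T.range
  let x' : E := e.repr.symm (WithLp.toLp 2 fun i => if (i : ℕ) < r then e.repr x i else 0)
  have hx' : ∀ i, e.repr x' i = if (i : ℕ) < r then e.repr x i else 0 := by simp [x']
  have hTx : T x' = T x := by
    rw [← sub_eq_zero, ← map_sub, ← norm_eq_zero, ← sq_eq_zero_iff,
      norm_sq_apply_eq_sum_singularValues]
    refine Finset.sum_eq_zero fun i _ => ?_
    by_cases hi : (i : ℕ) < r
    · have : e.repr (x' - x) i = 0 := by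
        rw [map_sub, PiLp.sub_apply, hx', if_pos hi, sub_self]
      rw [← he, this]; simp
    · rw [T.singularValues_eq_zero_iff_le_finrank_range.2 (not_lt.1 hi)]; simp
  refine ⟨x', hTx, le_of_sq_le_sq ?_ (by positivity)⟩
  rw [← hTx, norm_sq_apply_eq_sum_singularValues, mul_pow, ← e.repr.norm_map x',
    EuclideanSpace.norm_sq_eq, Finset.mul_sum]
  refine Finset.sum_le_sum fun i _ => ?_
  rw [Real.norm_eq_abs, sq_abs]
  by_cases hi : (i : ℕ) < r
  · gcongr
    exact h i hi
  · rw [hx', if_neg hi]; simp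

lemma norm_apply_le_of_forall_hasEigenvalue {S : E →ₗ[ℝ] E} (hS : S.IsSymmetric) {C : ℝ}
    (hC : 0 ≤ C) (h : ∀ t, Module.End.HasEigenvalue S t → |t| ≤ C) (x : E) :
    ‖S x‖ ≤ C * ‖x‖ := by
  set e := hS.eigenvectorBasis rfl
  refine le_of_sq_le_sq ?_ (by positivity)
  rw [← e.repr.norm_map, ← e.repr.norm_map x, mul_pow, EuclideanSpace.norm_sq_eq,
    EuclideanSpace.norm_sq_eq, Finset.mul_sum]
  refine Finset.sum_le_sum fun i _ => ?_
  rw [hS.eigenvectorBasis_apply_self_apply, norm_mul, mul_pow]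
  gcongr
  exact h _ (hS.hasEigenvalue_eigenvalues rfl i)

end Spectral

section EuclideanMatrix

variable {ι κ : Type*} [Fintype ι] [DecidableEq ι]

lemma finrank_range_toEuclideanLin [Finite κ] (A : Matrix κ ι ℝ) :
    Module.finrank ℝ (Matrix.toEuclideanLin A).range = A.rank := by
  cases nonempty_fintype κ
  exact (congrArg (fun f => Module.finrank ℝ (f A).range) (Matrix.toLpLin_eq_toLin 2 2)).trans
    (Matrix.rank_eq_finrank_range_toLin A _ _).symm

variable [Fintype κ]

lemma norm_toEuclideanLin_toLp (A : Matrix κ ι ℝ) (x : ι → ℝ) :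
    ‖Matrix.toEuclideanLin A (WithLp.toLp 2 x)‖ = l2Norm (A *ᵥ x) := by
  rw [l2Norm, Matrix.toLpLin_toLp, Matrix.toLin'_apply]

lemma l2Norm_mulVec_le_of_singularValues_le {A : Matrix κ ι ℝ} {C : ℝ} (hC : 0 ≤ C)
    (h : ∀ i < A.rank, (Matrix.toEuclideanLin A).singularValues i ≤ C) (x : ι → ℝ) :
    l2Norm (A *ᵥ x) ≤ C * l2Norm x := by
  rw [← finrank_range_toEuclideanLin] at h
  rw [← norm_toEuclideanLin_toLp]
  exact norm_apply_le_of_singularValues_le _ hC h _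

lemma exists_mulVec_eq_of_le_singularValues {A : Matrix κ ι ℝ} (hA : A.rank = Fintype.card κ)
    {C : ℝ} (hC : 0 < C) (h : ∀ i < A.rank, C ≤ (Matrix.toEuclideanLin A).singularValues i)
    (b : κ → ℝ) : ∃ x, A *ᵥ x = b ∧ C * l2Norm x ≤ l2Norm b := by
  rw [← finrank_range_toEuclideanLin] at h hA
  have hsurj : Function.Surjective (Matrix.toEuclideanLin A) :=
    LinearMap.range_eq_top.1 <| Submodule.eq_top_of_finrank_eq (by rw [hA, finrank_euclideanSpace])
  obtain ⟨x₀, hx₀⟩ := hsurj (WithLp.toLp 2 b)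
  obtain ⟨x, hx, hn⟩ := exists_preimage_norm_le_of_le_singularValues _ hC h x₀
  rw [hx₀] at hx hn
  exact ⟨x.ofLp, congrArg WithLp.ofLp hx, hn⟩

lemma l2Norm_mulVec_le_of_posSemidef {Q : Matrix ι ι ℝ} (hQ : Q.PosSemidef) {C : ℝ} (hC : 0 ≤ C)
    (h : ∀ t ∈ spectrum ℝ Q, t ≤ C) (x : ι → ℝ) : l2Norm (Q *ᵥ x) ≤ C * l2Norm x := by
  have hS := Matrix.isSymmetric_toEuclideanLin_iff.2 hQ.1
  rw [← norm_toEuclideanLin_toLp]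
  refine norm_apply_le_of_forall_hasEigenvalue hS hC (fun t ht => ?_) _
  have hmem : t ∈ spectrum ℝ Q := Matrix.spectrum_toLpLin (A := Q) 2 ▸ ht.mem_spectrum
  obtain ⟨i, hi⟩ := hQ.1.spectrum_real_eq_range_eigenvalues ▸ hmem
  rw [abs_of_nonneg (hi ▸ hQ.eigenvalues_nonneg i)]
  exact h t hmem

end EuclideanMatrix

section Farkas

variable {E ι : Type*} [AddCommGroup E] [Module ℝ E]

lemma exists_scaled_violator {s : Finset ι} {f : ι → E →ₗ[ℝ] ℝ} {f₀ g : E →ₗ[ℝ] ℝ}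
    (h : ∀ x, 0 ≤ f₀ x → (∀ i ∈ s, 0 ≤ f i x) → 0 ≤ g x)
    (hs : ¬ ∀ x, (∀ i ∈ s, 0 ≤ f i x) → 0 ≤ g x) :
    ∃ x₀, f₀ x₀ = -1 ∧ (∀ i ∈ s, 0 ≤ f i x₀) ∧ g x₀ < 0 := by
  push Not at hs
  obtain ⟨x₁, hfx, hgx⟩ := hs
  have hf₀ : f₀ x₁ < 0 := lt_of_not_ge fun h₀ => hgx.not_ge (h x₁ h₀ hfx)
  have hpos : 0 < (-(f₀ x₁))⁻¹ := inv_pos.2 (neg_pos.2 hf₀)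
  refine ⟨(-(f₀ x₁))⁻¹ • x₁, ?_, fun i hi => ?_, ?_⟩
  · rw [map_smul, smul_eq_mul, inv_neg, neg_mul, inv_mul_cancel₀ hf₀.ne]
  · rw [map_smul]
    exact mul_nonneg hpos.le (hfx i hi)
  · rw [map_smul]
    exact mul_neg_of_pos_of_neg hpos hgx

lemma exists_nonneg_sum_insert [DecidableEq ι] {s : Finset ι} {a : ι} (ha : a ∉ s)
    {f : ι → E →ₗ[ℝ] ℝ} {g : E →ₗ[ℝ] ℝ} {t : ℝ} (ht : 0 ≤ t) {c : ι → ℝ} (hc : ∀ i ∈ s, 0 ≤ c i)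
    (hg : g = t • f a + ∑ i ∈ s, c i • f i) :
    ∃ c : ι → ℝ, (∀ i ∈ insert a s, 0 ≤ c i) ∧ g = ∑ i ∈ insert a s, c i • f i := by
  have hne : ∀ i ∈ s, i ≠ a := fun i hi => ne_of_mem_of_not_mem hi ha
  refine ⟨Function.update c a t, ?_, ?_⟩
  · simp +contextual [hne, hc, ht]
  · rw [Finset.sum_insert ha, Function.update_self, hg]
    congr 1
    exact Finset.sum_congr rfl fun i hi => by rw [Function.update_of_ne (hne i hi)]

/-- **Farkas lemma** for finitely many linear functionals on a real vector space. -/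
lemma exists_nonneg_sum_smul_eq {s : Finset ι} {f : ι → E →ₗ[ℝ] ℝ} {g : E →ₗ[ℝ] ℝ}
    (h : ∀ x, (∀ i ∈ s, 0 ≤ f i x) → 0 ≤ g x) :
    ∃ c : ι → ℝ, (∀ i ∈ s, 0 ≤ c i) ∧ g = ∑ i ∈ s, c i • f i := by
  classical
  induction s using Finset.induction_on generalizing f g with
  | empty =>
    refine ⟨0, by simp, LinearMap.ext fun x => ?_⟩
    have hx := h x (by simp)
    have hneg := h (-x) (by simp)
    rw [map_neg] at hneg
    simp only [Finset.sum_empty, LinearMap.zero_apply]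
    linarith
  | insert a s ha ih =>
    by_cases hs : ∀ x, (∀ i ∈ s, 0 ≤ f i x) → 0 ≤ g x
    · obtain ⟨c, hc, hg⟩ := ih hs
      exact exists_nonneg_sum_insert ha le_rfl hc (by rw [zero_smul, zero_add, hg])
    · obtain ⟨x₀, hfa, hfx, hgx⟩ :=
        exists_scaled_violator (fun x h₀ hx => h x (by simpa using ⟨h₀, hx⟩)) hs
      -- Projecting along `x₀` onto the kernel of `f a` makes the constraint `f a` redundant.
      obtain ⟨c, hc, hg⟩ := ih (f := fun i => f i + f i x₀ • f a) (g := g + g x₀ • f a)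
        fun x hx => by
          have := h (x + f a x • x₀) (by simpa [hfa, mul_comm] using hx)
          simpa [mul_comm] using this
      refine exists_nonneg_sum_insert ha (t := ∑ i ∈ s, c i * f i x₀ - g x₀) ?_ hc ?_
      · exact sub_nonneg.2 <| hgx.le.trans <|
          Finset.sum_nonneg fun i hi => mul_nonneg (hc i hi) (hfx i hi)
      · refine LinearMap.ext fun x => ?_
        have hx := congrArg (fun l => l x) hg
        simp only [LinearMap.add_apply, LinearMap.smul_apply, LinearMap.sum_apply, smul_eq_mul,
          mul_add, Finset.sum_add_distrib, sub_mul, Finset.sum_mul, mul_assoc] at hx ⊢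
        linarith

end Farkas

lemma exists_transpose_mulVec_eq {ι κ : Type*} [Fintype ι] [Fintype κ] {A : Matrix ι κ ℝ}
    {v : κ → ℝ} (h : ∀ d, A *ᵥ d = 0 → v ⬝ᵥ d = 0) : ∃ y, Aᵀ *ᵥ y = v := by
  classical
  have hmem : dotProductEquiv ℝ κ v ∈ A.mulVecLin.ker.dualAnnihilator :=
    (Submodule.mem_dualAnnihilator _).2 fun d hd => h d hd
  rw [← LinearMap.range_dualMap_eq_dualAnnihilator_ker] at hmem
  obtain ⟨φ, hφ⟩ := hmem
  obtain ⟨y, rfl⟩ := (dotProductEquiv ℝ ι).surjective φ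
  refine ⟨y, dotProduct_eq _ _ fun d => ?_⟩
  rw [mulVec_transpose, ← dotProduct_mulVec]
  exact congrArg (fun l => l d) hφ

namespace QP

variable {n m : ℕ} {P : QP n m}

section KarushKuhnTucker

variable {x : Fin n → ℝ} {y : Fin m → ℝ} {z d : Fin n → ℝ}

lemma dotProduct_mulVec_nonneg (hQ : P.Q.PosSemidef) (x : Fin n → ℝ) : 0 ≤ x ⬝ᵥ P.Q *ᵥ x := by
  simpa using hQ.dotProduct_mulVec_nonneg x

lemma dotProduct_mulVec_comm (hQ : P.Q.PosSemidef) (x y : Fin n → ℝ) :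
    x ⬝ᵥ P.Q *ᵥ y = y ⬝ᵥ P.Q *ᵥ x := by
  rw [dotProduct_mulVec, ← mulVec_transpose, show P.Qᵀ = P.Q from hQ.1, dotProduct_comm]

lemma primalObj_add_smul (hQ : P.Q.PosSemidef) (x d : Fin n → ℝ) (t : ℝ) :
    P.primalObj (x + t • d)
      = P.primalObj x + t * ((P.Q *ᵥ x + P.c) ⬝ᵥ d + t * (1 / 2 * (d ⬝ᵥ P.Q *ᵥ d))) := by
  simp only [primalObj, mulVec_add, mulVec_smul, dotProduct_add, add_dotProduct,
    smul_dotProduct, dotProduct_smul, smul_eq_mul]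
  rw [dotProduct_mulVec_comm hQ x d, dotProduct_comm (P.Q *ᵥ x) d]
  ring

lemma PrimalFeasible.eventually_add_smul (hx : P.PrimalFeasible x) (hA : P.A *ᵥ d = 0)
    (hd : ∀ i, x i = 0 → 0 ≤ d i) : ∀ᶠ t in 𝓝[>] (0 : ℝ), P.PrimalFeasible (x + t • d) := by
  have hpos : ∀ᶠ t in 𝓝[>] (0 : ℝ), ∀ i, 0 ≤ x i + t * d i := by
    rw [eventually_all]
    intro i
    rcases (hx.2 i).eq_or_lt' with h0 | hxi
    · filter_upwards [self_mem_nhdsWithin] with t ht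
      rw [h0]
      simpa using mul_nonneg (le_of_lt ht) (hd i h0)
    · have hlim : Tendsto (fun t : ℝ => x i + t * d i) (𝓝[>] 0) (𝓝 (x i + 0 * d i)) :=
        (Continuous.tendsto (by fun_prop) 0).mono_left nhdsWithin_le_nhds
      rw [zero_mul, add_zero] at hlim
      exact (hlim.eventually (lt_mem_nhds hxi)).mono fun _ h => h.le
  filter_upwards [hpos] with t ht
  exact ⟨by rw [mulVec_add, mulVec_smul, hA, smul_zero, add_zero, hx.1], ht⟩

lemma gradient_dotProduct_nonneg (hQ : P.Q.PosSemidef) (hx : P.PrimalFeasible x)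
    (hopt : ∀ x', P.PrimalFeasible x' → P.primalObj x ≤ P.primalObj x') (hA : P.A *ᵥ d = 0)
    (hd : ∀ i, x i = 0 → 0 ≤ d i) : 0 ≤ (P.Q *ᵥ x + P.c) ⬝ᵥ d := by
  have hquot : ∀ᶠ t in 𝓝[>] (0 : ℝ), 0 ≤ (P.Q *ᵥ x + P.c) ⬝ᵥ d + t * (1 / 2 * (d ⬝ᵥ P.Q *ᵥ d)) := by
    filter_upwards [hx.eventually_add_smul hA hd, self_mem_nhdsWithin] with t ht htpos
    have h := hopt _ ht
    rw [primalObj_add_smul hQ] at h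
    exact nonneg_of_mul_nonneg_right (le_add_iff_nonneg_right _ |>.1 h) htpos
  have hlim : Tendsto (fun t : ℝ => (P.Q *ᵥ x + P.c) ⬝ᵥ d + t * (1 / 2 * (d ⬝ᵥ P.Q *ᵥ d)))
      (𝓝[>] 0) (𝓝 ((P.Q *ᵥ x + P.c) ⬝ᵥ d + 0 * (1 / 2 * (d ⬝ᵥ P.Q *ᵥ d)))) :=
    (Continuous.tendsto (by fun_prop) 0).mono_left nhdsWithin_le_nhds
  rw [zero_mul, add_zero] at hlim
  exact ge_of_tendsto hlim hquot

lemma exists_dualFeasible_complementary (hQ : P.Q.PosSemidef) (hx : P.PrimalFeasible x)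
    (hopt : ∀ x', P.PrimalFeasible x' → P.primalObj x ≤ P.primalObj x') :
    ∃ (y : Fin m → ℝ) (z : Fin n → ℝ), P.DualFeasible x y z ∧ x ⬝ᵥ z = 0 := by
  let restrict (v : Fin n → ℝ) : P.A.mulVecLin.ker →ₗ[ℝ] ℝ :=
    dotProductEquiv ℝ (Fin n) v ∘ₗ P.A.mulVecLin.ker.subtype
  obtain ⟨c, hc, hg⟩ := exists_nonneg_sum_smul_eq (s := {i | x i = 0})
    (f := fun i => restrict (Pi.single i 1)) (g := restrict (P.Q *ᵥ x + P.c))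
    fun d hd => gradient_dotProduct_nonneg hQ hx hopt d.2 fun i hi => by
      simpa [restrict] using hd i (by simpa using hi)
  let z : Fin n → ℝ := fun i => if x i = 0 then c i else 0
  have hz (d : Fin n → ℝ) (hd : P.A *ᵥ d = 0) : (P.Q *ᵥ x + P.c - z) ⬝ᵥ d = 0 := by
    have h := LinearMap.congr_fun hg ⟨d, hd⟩
    have hsingle (i : Fin n) : restrict (Pi.single i 1) ⟨d, hd⟩ = d i := by simp [restrict]
    rw [LinearMap.sum_apply] at h
    simp only [LinearMap.smul_apply, hsingle, smul_eq_mul, Finset.sum_filter] at h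
    rw [sub_dotProduct, sub_eq_zero]
    exact h.trans (by simp [z, dotProduct])
  obtain ⟨y, hy⟩ := exists_transpose_mulVec_eq hz
  refine ⟨y, z, ⟨by rw [hy, sub_add_cancel], fun i => ?_⟩, Finset.sum_eq_zero fun i _ => ?_⟩
  · by_cases hi : x i = 0
    · simpa [z, hi] using hc i (by simpa using hi)
    · simp [z, hi]
  · by_cases hi : x i = 0 <;> simp [z, hi]

lemma DualFeasible.dotProduct_add_dotProduct (h : P.DualFeasible x y z) (hx : P.PrimalFeasible x) :
    P.b ⬝ᵥ y + x ⬝ᵥ z = x ⬝ᵥ (P.Q *ᵥ x + P.c) := by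
  rw [← h.1, dotProduct_add, mulVec_transpose, dotProduct_comm x (y ᵥ* P.A), ← dotProduct_mulVec,
    hx.1, dotProduct_comm y]

lemma IsOptimal.complementary (hQ : P.Q.PosSemidef) (h : P.IsOptimal x y z) : x ⬝ᵥ z = 0 := by
  obtain ⟨⟨hx, hopt⟩, hyz, hdopt⟩ := h
  obtain ⟨y', z', hyz', hcompl⟩ := exists_dualFeasible_complementary hQ hx hopt
  have hobj : P.b ⬝ᵥ y' ≤ P.b ⬝ᵥ y := sub_le_sub_iff_right _ |>.1 (hdopt x y' z' hyz')
  have hgap := (hyz.dotProduct_add_dotProduct hx).trans (hyz'.dotProduct_add_dotProduct hx).symm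
  exact le_antisymm (by linarith) (Finset.sum_nonneg fun i _ => mul_nonneg (hx.2 i) (hyz.2 i))

end KarushKuhnTucker

end QP

/-- The vector space of primal-dual triples `(x, y, z)`. -/
abbrev PrimalDual (n m : ℕ) : Type := (Fin n → ℝ) × (Fin m → ℝ) × (Fin n → ℝ)

namespace PrimalDual

variable {n m : ℕ}

/-- The Euclidean norm of `(x, z)`, which the seminorm `‖·‖_𝒜` minimizes. -/
noncomputable def size (v : PrimalDual n m) : ℝ := l2Norm (Sum.elim v.1 v.2.2)

/-- The linear map `(x, y, z) ↦ (y, -x)`, which pairs with `QP.kkt` to a monotone form and also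
gives the proximal terms of the neighborhood. -/
def skew : PrimalDual n m →ₗ[ℝ] (Fin m ⊕ Fin n → ℝ) where
  toFun v := Sum.elim v.2.1 (-v.1)
  map_add' u v := by ext (i | i) <;> simp [add_comm]
  map_smul' a v := by ext (i | i) <;> simp

lemma size_nonneg (v : PrimalDual n m) : 0 ≤ size v := l2Norm_nonneg _

lemma size_add_le (u v : PrimalDual n m) : size (u + v) ≤ size u + size v := by
  have h : Sum.elim (u + v).1 (u + v).2.2 = Sum.elim u.1 u.2.2 + Sum.elim v.1 v.2.2 := by
    ext (i | i) <;> simp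
  rw [size, h]
  exact l2Norm_add_le _ _

lemma size_smul (a : ℝ) (v : PrimalDual n m) : size (a • v) = |a| * size v := by
  have h : Sum.elim (a • v).1 (a • v).2.2 = a • Sum.elim v.1 v.2.2 := by
    ext (i | i) <;> simp
  rw [size, h, l2Norm_smul, size]

lemma l2Norm_fst_le_size (v : PrimalDual n m) : l2Norm v.1 ≤ size v := by
  simpa [size] using l2Norm_comp_inl_le (Sum.elim v.1 v.2.2)

lemma l2Norm_snd_snd_le_size (v : PrimalDual n m) : l2Norm v.2.2 ≤ size v := by
  simpa [size] using l2Norm_comp_inr_le (Sum.elim v.1 v.2.2)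

end PrimalDual

/-- A triple as an element of the vector space `PrimalDual n m`. -/
def Triple.vec {n m : ℕ} (w : Triple n m) : PrimalDual n m := (w.x, w.y, w.z)

lemma pairNorm_eq_l2Norm {p q : ℕ} (u : Fin p → ℝ) (v : Fin q → ℝ) :
    pairNorm u v = l2Norm (Sum.elim u v) := by
  rw [pairNorm, ← Real.sqrt_sq (l2Norm_nonneg (Sum.elim u v)), l2Norm_sq_sumElim, l2Norm_sq,
    l2Norm_sq]

namespace QP

open PrimalDual

variable {n m : ℕ} (P : QP n m)

/-- The linear map `(x, y, z) ↦ (Ax, -Qx + Aᵀy + z)`: the left-hand sides of the equality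
constraints of (P) and (D), stacked. -/
def kkt : PrimalDual n m →ₗ[ℝ] (Fin m ⊕ Fin n → ℝ) where
  toFun v := Sum.elim (P.A *ᵥ v.1) (-(P.Q *ᵥ v.1) + P.Aᵀ *ᵥ v.2.1 + v.2.2)
  map_add' u v := by ext (i | i) <;> simp [mulVec_add]; ring
  map_smul' a v := by ext (i | i) <;> simp [mulVec_smul]; ring

/-- The seminorm `‖·‖_𝒜` of a stacked vector. -/
noncomputable def stackedSemiNorm (r : Fin m ⊕ Fin n → ℝ) : ℝ :=
  semiNorm P (r ∘ Sum.inl) (r ∘ Sum.inr)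

variable {P}

lemma kkt_dotProduct_skew (v : PrimalDual n m) :
    P.kkt v ⬝ᵥ skew v = v.1 ⬝ᵥ P.Q *ᵥ v.1 - v.1 ⬝ᵥ v.2.2 := by
  have hA : (P.A *ᵥ v.1) ⬝ᵥ v.2.1 = (P.Aᵀ *ᵥ v.2.1) ⬝ᵥ v.1 := by
    rw [mulVec_transpose, ← dotProduct_mulVec, dotProduct_comm]
  have hsplit : P.kkt v ⬝ᵥ skew v
      = (P.A *ᵥ v.1) ⬝ᵥ v.2.1 + (-(P.Q *ᵥ v.1) + P.Aᵀ *ᵥ v.2.1 + v.2.2) ⬝ᵥ (-v.1) :=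
    sumElim_dotProduct_sumElim ..
  rw [hsplit, hA, dotProduct_neg, add_dotProduct, add_dotProduct, neg_dotProduct,
    dotProduct_comm (P.Q *ᵥ v.1), dotProduct_comm v.2.2]
  ring

lemma neg_kkt_dotProduct_skew_le (hQ : P.Q.PosSemidef) (v : PrimalDual n m) :
    -(P.kkt v ⬝ᵥ skew v) ≤ v.1 ⬝ᵥ v.2.2 := by
  rw [kkt_dotProduct_skew]
  linarith [dotProduct_mulVec_nonneg hQ v.1]

lemma stackedSemiNorm_eq_sInf (r : Fin m ⊕ Fin n → ℝ) :
    P.stackedSemiNorm r = sInf (size '' {v | P.kkt v = r}) := by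
  rw [stackedSemiNorm, semiNorm]
  congr 1
  ext t
  constructor
  · rintro ⟨x, y, z, hp, hd, rfl⟩
    exact ⟨(x, y, z), by simp [kkt, hp, hd], (pairNorm_eq_l2Norm x z).symm⟩
  · rintro ⟨v, rfl, rfl⟩
    exact ⟨v.1, v.2.1, v.2.2, rfl, rfl, (pairNorm_eq_l2Norm v.1 v.2.2).symm⟩

lemma stackedSemiNorm_kkt_le (v : PrimalDual n m) : P.stackedSemiNorm (P.kkt v) ≤ size v := by
  rw [stackedSemiNorm_eq_sInf]
  exact csInf_le ⟨0, by rintro _ ⟨v, -, rfl⟩; exact size_nonneg v⟩ ⟨v, rfl, rfl⟩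

lemma exists_kkt_eq_size_lt (hA : Function.Surjective P.A.mulVec) {r : Fin m ⊕ Fin n → ℝ} {t : ℝ}
    (ht : P.stackedSemiNorm r < t) : ∃ v, P.kkt v = r ∧ size v < t := by
  obtain ⟨x, hx⟩ := hA (r ∘ Sum.inl)
  have hne : {v | P.kkt v = r}.Nonempty :=
    ⟨(x, 0, r ∘ Sum.inr + P.Q *ᵥ x), by ext (i | i) <;> simp [kkt, hx]⟩
  rw [stackedSemiNorm_eq_sInf] at ht
  obtain ⟨_, ⟨v, hv, rfl⟩, hlt⟩ := exists_lt_of_csInf_lt (hne.image size) ht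
  exact ⟨v, hv, hlt⟩

lemma stackedSemiNorm_add_le (hA : Function.Surjective P.A.mulVec) (r r' : Fin m ⊕ Fin n → ℝ) :
    P.stackedSemiNorm (r + r') ≤ P.stackedSemiNorm r + P.stackedSemiNorm r' := by
  refine le_of_forall_pos_le_add fun ε hε => ?_
  obtain ⟨v, rfl, hv⟩ := exists_kkt_eq_size_lt hA (lt_add_of_pos_right (P.stackedSemiNorm r)
    (half_pos hε))
  obtain ⟨v', rfl, hv'⟩ := exists_kkt_eq_size_lt hA (lt_add_of_pos_right (P.stackedSemiNorm r')
    (half_pos hε))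
  rw [← map_add]
  linarith [stackedSemiNorm_kkt_le (P := P) (v + v'), size_add_le v v']

lemma stackedSemiNorm_smul_le (hA : Function.Surjective P.A.mulVec) (a : ℝ)
    (r : Fin m ⊕ Fin n → ℝ) : P.stackedSemiNorm (a • r) ≤ |a| * P.stackedSemiNorm r := by
  have hlim : Tendsto (fun t => |a| * t) (𝓝[>] P.stackedSemiNorm r)
      (𝓝 (|a| * P.stackedSemiNorm r)) :=
    (Continuous.tendsto (by fun_prop) _).mono_left nhdsWithin_le_nhds
  refine ge_of_tendsto hlim ?_
  filter_upwards [self_mem_nhdsWithin] with t ht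
  obtain ⟨v, rfl, hv⟩ := exists_kkt_eq_size_lt hA ht
  calc P.stackedSemiNorm (a • P.kkt v) ≤ size (a • v) := by
        rw [← map_smul]; exact stackedSemiNorm_kkt_le _
    _ ≤ |a| * t := by
        rw [size_smul]; exact mul_le_mul_of_nonneg_left hv.le (abs_nonneg a)

end QP

namespace Instance

open PrimalDual

variable {n m : ℕ} (I : Instance n m)

/-- The stacked right-hand side `(b, c)`. -/
def rhs : Fin m ⊕ Fin n → ℝ := Sum.elim I.P.b I.P.c

/-- The stacked initial residual `(b̄, c̄)`. -/
def rbar : Fin m ⊕ Fin n → ℝ := Sum.elim I.bbar I.cbar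

/-- The pair of estimates `(lam, -ζ)`, stacked so that `μ • (skew v - anchor ζ lam)` are the
proximal terms of the neighborhood. -/
def anchor (ζ : Fin n → ℝ) (lam : Fin m → ℝ) : Fin m ⊕ Fin n → ℝ := Sum.elim lam (-ζ)

/-- The stacked vector `(μ / μ₀) (b̃, c̃)` of the neighborhood `𝒩_μ` with anchor `a`. -/
noncomputable def deviation (μ : ℝ) (a : Fin m ⊕ Fin n → ℝ) (v : PrimalDual n m) :
    Fin m ⊕ Fin n → ℝ :=
  I.P.kkt v + μ • (skew v - a) - I.rhs - (μ / I.mu0) • I.rbar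

/-- The two bounds on `(b̃, c̃)` in the neighborhood, scaled by `t`. -/
def Within (t : ℝ) (r : Fin m ⊕ Fin n → ℝ) : Prop :=
  l2Norm r ≤ I.par.CN * t ∧ I.P.stackedSemiNorm r ≤ I.par.γA * I.par.ρ * t

variable {I} {w : Triple n m} {s : State n m} {d : Triple n m} {μ t t' : ℝ}
  {r r' : Fin m ⊕ Fin n → ℝ}

lemma Within.add (hA : Function.Surjective I.P.A.mulVec) (h : I.Within t r) (h' : I.Within t' r') :
    I.Within (t + t') (r + r') := by
  constructor
  · rw [mul_add]
    exact (l2Norm_add_le r r').trans (add_le_add h.1 h'.1)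
  · rw [mul_add]
    exact (QP.stackedSemiNorm_add_le hA r r').trans (add_le_add h.2 h'.2)

lemma Within.smul (hA : Function.Surjective I.P.A.mulVec) {a : ℝ} (ha : 0 ≤ a)
    (h : I.Within t r) : I.Within (a * t) (a • r) := by
  constructor
  · rw [l2Norm_smul, abs_of_nonneg ha, mul_left_comm]
    exact mul_le_mul_of_nonneg_left h.1 ha
  · refine (QP.stackedSemiNorm_smul_le hA a r).trans ?_
    rw [abs_of_nonneg ha, mul_left_comm]
    exact mul_le_mul_of_nonneg_left h.2 ha

lemma within_sumElim {u : Fin m → ℝ} {v : Fin n → ℝ} : I.Within t (Sum.elim u v) ↔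
    pairNorm u v ≤ I.par.CN * t ∧ semiNorm I.P u v ≤ I.par.γA * I.par.ρ * t := by
  rw [Within, QP.stackedSemiNorm, pairNorm_eq_l2Norm, Sum.elim_comp_inl, Sum.elim_comp_inr]

lemma kkt_start : I.P.kkt I.start.vec = I.rhs + I.rbar := by
  ext (i | i) <;> simp [QP.kkt, rhs, rbar, bbar, cbar, Triple.vec]

lemma deviation_eq_smul_sumElim_iff {ζ : Fin n → ℝ} {lam : Fin m → ℝ} {u : Fin m → ℝ}
    {v : Fin n → ℝ} : I.deviation μ (anchor ζ lam) w.vec = (μ / I.mu0) • Sum.elim u v ↔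
      I.P.A *ᵥ w.x + μ • (w.y - lam) = I.P.b + (μ / I.mu0) • (I.bbar + u) ∧
      -(I.P.Q *ᵥ w.x) + I.P.Aᵀ *ᵥ w.y + w.z - μ • (w.x - ζ)
        = I.P.c + (μ / I.mu0) • (I.cbar + v) := by
  simp only [deviation, QP.kkt, skew, anchor, rhs, rbar, Triple.vec, funext_iff, Sum.forall,
    LinearMap.coe_mk, AddHom.coe_mk, Pi.add_apply, Pi.sub_apply, Pi.smul_apply, Pi.neg_apply,
    Sum.elim_inl, Sum.elim_inr, smul_eq_mul]
  refine and_congr (forall_congr' fun i => ?_) (forall_congr' fun i => ?_) <;>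
    constructor <;> intro h <;> linarith

lemma deviation_mul (σ : ℝ) (a : Fin m ⊕ Fin n → ℝ) (v : PrimalDual n m) :
    I.deviation (σ * μ) a v = I.deviation μ a v - ((1 - σ) * μ) • (skew v - a)
      + ((1 - σ) * (μ / I.mu0)) • I.rbar := by
  rw [deviation, deviation, mul_div_assoc]
  module

lemma mem_nbhd_iff (hA : Function.Surjective I.P.A.mulVec) (h0 : 0 < I.mu0) (hμ : 0 < μ)
    {ζ : Fin n → ℝ} {lam : Fin m → ℝ} : w ∈ I.nbhd μ ζ lam ↔
      I.Within (μ / I.mu0) (I.deviation μ (anchor ζ lam) w.vec) ∧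
      ∀ i, 0 < w.x i ∧ 0 < w.z i ∧ I.par.γμ * μ ≤ w.x i * w.z i := by
  have hθ : 0 < μ / I.mu0 := div_pos hμ h0
  refine and_congr_left fun _ => ⟨?_, fun h => ?_⟩
  · rintro ⟨u, v, hp, hd, hnorm, hsemi⟩
    rw [deviation_eq_smul_sumElim_iff.2 ⟨hp, hd⟩]
    have hW : I.Within 1 (Sum.elim u v) :=
      within_sumElim.2 ⟨by simpa using hnorm, by simpa using hsemi⟩
    simpa using hW.smul hA hθ.le
  · have hW := h.smul hA (inv_nonneg.2 hθ.le)
    rw [inv_mul_cancel₀ hθ.ne'] at hW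
    set q := (μ / I.mu0)⁻¹ • I.deviation μ (anchor ζ lam) w.vec with hq
    rw [← Sum.elim_comp_inl_inr q, within_sumElim, mul_one, mul_one] at hW
    obtain ⟨hp, hd⟩ := deviation_eq_smul_sumElim_iff.1 <| show I.deviation μ (anchor ζ lam) w.vec
      = (μ / I.mu0) • Sum.elim (q ∘ Sum.inl) (q ∘ Sum.inr) by
        rw [Sum.elim_comp_inl_inr, hq, smul_inv_smul₀ hθ.ne']
    exact ⟨_, _, hp, hd, hW.1, hW.2⟩

lemma updateTest_iff : I.UpdateTest w ↔
    I.Within (w.mu / I.mu0) (I.deviation w.mu (anchor w.x w.y) w.vec) := by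
  have h : I.deviation w.mu (anchor w.x w.y) w.vec
      = Sum.elim (I.P.A *ᵥ w.x - I.P.b - (w.mu / I.mu0) • I.bbar)
        (-(I.P.Q *ᵥ w.x) + I.P.Aᵀ *ᵥ w.y + w.z - I.P.c - (w.mu / I.mu0) • I.cbar) := by
    ext (i | i) <;> simp [deviation, QP.kkt, skew, anchor, rhs, rbar, Triple.vec]
  rw [h, within_sumElim, UpdateTest]

/-- `d` solves the stacked Newton system at `w` with centering parameter `σ` and residual `r`. -/
structure IsNewtonDirection (I : Instance n m) (a : Fin m ⊕ Fin n → ℝ) (w : Triple n m) (σ : ℝ)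
    (r : Fin m ⊕ Fin n → ℝ) (d : PrimalDual n m) : Prop where
  σmin_le : I.par.σmin ≤ σ
  le_σmax : σ ≤ I.par.σmax
  within : I.Within (I.par.σmin / 4 * (w.mu / I.mu0)) r
  kkt_add : I.P.kkt d + w.mu • skew d = r - I.deviation (σ * w.mu) a w.vec
  compl : ∀ i, w.z i * d.1 i + w.x i * d.2.2 i = σ * w.mu - w.x i * w.z i

lemma IsDirection.exists_isNewtonDirection (h : I.IsDirection s d) :
    ∃ σ r, I.IsNewtonDirection (anchor s.ζ s.lam) s.pt σ r d.vec := by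
  obtain ⟨σ, rd, rp, _, hmin, hmax, ⟨hd, hp, hc⟩, rfl, hnorm, hsemi⟩ := h
  refine ⟨σ, Sum.elim rp rd, hmin, hmax, within_sumElim.2 ⟨?_, ?_⟩, ?_, fun i => ?_⟩
  · exact hnorm.trans_eq (by ring)
  · exact hsemi.trans_eq (by ring)
  · simp only [funext_iff, Pi.add_apply, Pi.sub_apply, Pi.neg_apply, Pi.smul_apply,
      smul_eq_mul] at hp hd
    simp only [deviation, QP.kkt, skew, anchor, rhs, rbar, Triple.vec, funext_iff, Sum.forall,
      LinearMap.coe_mk, AddHom.coe_mk, Pi.add_apply, Pi.sub_apply, Pi.smul_apply, Pi.neg_apply,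
      Sum.elim_inl, Sum.elim_inr, smul_eq_mul]
    exact ⟨fun i => by linarith [hp i], fun i => by linarith [hd i]⟩
  · have hi := congrFun hc i
    simp only [Pi.add_apply, Pi.mul_apply, Pi.neg_apply, Pi.sub_apply, Pi.zero_apply] at hi
    exact hi.trans (by ring)

end Instance

section DataBounds

open PrimalDual

variable {n m : ℕ} {K K' : ℝ}

/-- The constant `K` controls all data of the instance: the parameters are bounded by `K` and
bounded away from the ends of their ranges by `K⁻¹`, the matrices and a right inverse of `A` have
norm at most `K`, and the vectors, including a complementary solution of the optimality conditions,
have entries of size at most `K`, up to a factor that allows for counting the entries. -/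
structure Instance.Bounded (I : Instance n m) (K : ℝ) : Prop where
  valid : I.par.Valid
  n_pos : 0 < n
  m_le : m ≤ n
  one_le : 1 ≤ K
  ρ_le : I.par.ρ ≤ K
  CN_le : I.par.CN ≤ K
  one_le_mul_ρ : 1 ≤ K * I.par.ρ
  one_le_mul_CN : 1 ≤ K * I.par.CN
  one_le_mul_γA : 1 ≤ K * I.par.γA
  one_le_mul_one_sub_γA : 1 ≤ K * (1 - I.par.γA)
  one_le_mul_γμ : 1 ≤ K * I.par.γμ
  one_le_mul_one_sub_γμ : 1 ≤ K * (1 - I.par.γμ)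
  one_le_mul_σmin : 1 ≤ K * I.par.σmin
  Q_posSemidef : I.P.Q.PosSemidef
  Q_le : ∀ x, l2Norm (I.P.Q *ᵥ x) ≤ K * l2Norm x
  A_le : ∀ x, l2Norm (I.P.A *ᵥ x) ≤ K * l2Norm x
  exists_preimage : ∀ b, ∃ x, I.P.A *ᵥ x = b ∧ l2Norm x ≤ K * l2Norm b
  rhs_le : l2Norm I.rhs ≤ K * n
  y0_le : l2Norm I.y0 ≤ K * n
  exists_solution : ∃ v, I.P.kkt v = I.rhs ∧
    (∀ i, (0 ≤ v.1 i ∧ v.1 i ≤ K) ∧ 0 ≤ v.2.2 i ∧ v.2.2 i ≤ K) ∧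
    v.1 ⬝ᵥ v.2.2 = 0 ∧ l2Norm v.2.1 ≤ K * n

lemma pow_mul_le_pow_mul (hK : 1 ≤ K) {c : ℝ} (hc : 0 ≤ c) {i j : ℕ} (hij : i ≤ j) :
    K ^ i * c ≤ K ^ j * c :=
  mul_le_mul_of_nonneg_right (pow_le_pow_right₀ hK hij) hc

namespace Instance

variable {I : Instance n m}

namespace Bounded

variable (h : I.Bounded K)

include h

lemma ρ_pos : 0 < I.par.ρ := h.valid.2.2.2.2

lemma CN_pos : 0 < I.par.CN := h.valid.2.1

lemma γA_pos : 0 < I.par.γA := h.valid.2.2.1.1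

lemma γA_lt_one : I.par.γA < 1 := h.valid.2.2.1.2

lemma γμ_pos : 0 < I.par.γμ := h.valid.2.2.2.1.1

lemma γμ_lt_one : I.par.γμ < 1 := h.valid.2.2.2.1.2

lemma σmin_pos : 0 < I.par.σmin := h.valid.1.1

lemma pos : 0 < K := zero_lt_one.trans_le h.one_le

lemma one_le_n : (1 : ℝ) ≤ n := Nat.one_le_cast.2 h.n_pos

lemma mono (hK : K ≤ K') : I.Bounded K' where
  valid := h.valid
  n_pos := h.n_pos
  m_le := h.m_le
  one_le := h.one_le.trans hK
  ρ_le := h.ρ_le.trans hK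
  CN_le := h.CN_le.trans hK
  one_le_mul_ρ := h.one_le_mul_ρ.trans (mul_le_mul_of_nonneg_right hK h.ρ_pos.le)
  one_le_mul_CN := h.one_le_mul_CN.trans (mul_le_mul_of_nonneg_right hK h.CN_pos.le)
  one_le_mul_γA := h.one_le_mul_γA.trans (mul_le_mul_of_nonneg_right hK h.γA_pos.le)
  one_le_mul_one_sub_γA := h.one_le_mul_one_sub_γA.trans
    (mul_le_mul_of_nonneg_right hK (sub_nonneg.2 h.γA_lt_one.le))
  one_le_mul_γμ := h.one_le_mul_γμ.trans (mul_le_mul_of_nonneg_right hK h.γμ_pos.le)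
  one_le_mul_one_sub_γμ := h.one_le_mul_one_sub_γμ.trans
    (mul_le_mul_of_nonneg_right hK (sub_nonneg.2 h.γμ_lt_one.le))
  one_le_mul_σmin := h.one_le_mul_σmin.trans (mul_le_mul_of_nonneg_right hK h.σmin_pos.le)
  Q_posSemidef := h.Q_posSemidef
  Q_le x := (h.Q_le x).trans (mul_le_mul_of_nonneg_right hK (l2Norm_nonneg x))
  A_le x := (h.A_le x).trans (mul_le_mul_of_nonneg_right hK (l2Norm_nonneg x))
  exists_preimage b := (h.exists_preimage b).imp fun _ hx =>
    ⟨hx.1, hx.2.trans (mul_le_mul_of_nonneg_right hK (l2Norm_nonneg b))⟩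
  rhs_le := h.rhs_le.trans (mul_le_mul_of_nonneg_right hK n.cast_nonneg)
  y0_le := h.y0_le.trans (mul_le_mul_of_nonneg_right hK n.cast_nonneg)
  exists_solution := h.exists_solution.imp fun _ hv =>
    ⟨hv.1, fun i => ⟨(hv.2.1 i).1.imp_right fun hx => hx.trans hK,
      (hv.2.1 i).2.imp_right fun hz => hz.trans hK⟩, hv.2.2.1,
      hv.2.2.2.trans (mul_le_mul_of_nonneg_right hK n.cast_nonneg)⟩

lemma mu0_eq : I.mu0 = I.par.ρ ^ 2 := by
  have hn : (n : ℝ) ≠ 0 := Nat.cast_ne_zero.2 h.n_pos.ne'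
  simp only [mu0, Triple.mu, start, dotProduct, Finset.sum_const, Finset.card_univ,
    Fintype.card_fin, nsmul_eq_mul]
  field_simp

lemma mu0_pos : 0 < I.mu0 := h.mu0_eq ▸ pow_pos h.ρ_pos 2

lemma mu0_le : I.mu0 ≤ K ^ 2 := h.mu0_eq ▸ pow_le_pow_left₀ h.ρ_pos.le h.ρ_le 2

lemma one_le_mul_mu0 : 1 ≤ K ^ 2 * I.mu0 := by
  rw [h.mu0_eq, ← mul_pow]
  exact one_le_pow₀ h.one_le_mul_ρ

lemma surjective : Function.Surjective I.P.A.mulVec := fun b =>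
  (h.exists_preimage b).imp fun _ => And.left

lemma l2Norm_transpose_le (y : Fin m → ℝ) : l2Norm (I.P.Aᵀ *ᵥ y) ≤ K * l2Norm y :=
  l2Norm_transpose_mulVec_le h.pos.le h.A_le y

lemma l2Norm_kkt_le (v : PrimalDual n m) :
    l2Norm (I.P.kkt v) ≤ K * (2 * l2Norm v.1 + l2Norm v.2.1) + l2Norm v.2.2 := by
  have hsum : l2Norm (-(I.P.Q *ᵥ v.1) + I.P.Aᵀ *ᵥ v.2.1 + v.2.2)
      ≤ l2Norm (I.P.Q *ᵥ v.1) + l2Norm (I.P.Aᵀ *ᵥ v.2.1) + l2Norm v.2.2 := by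
    rw [← l2Norm_neg (I.P.Q *ᵥ v.1)]
    exact (l2Norm_add_le _ _).trans (add_le_add_left (l2Norm_add_le _ _) _)
  have hsplit : l2Norm (I.P.kkt v) ≤ _ := l2Norm_sumElim_le (I.P.A *ᵥ v.1) _
  linarith [h.A_le v.1, h.Q_le v.1, h.l2Norm_transpose_le v.2.1]

lemma l2Norm_dual_le_add_smul (v : PrimalDual n m) (μ : ℝ) : l2Norm v.2.1 ≤
    K * (l2Norm (I.P.kkt v + μ • skew v) + (K + |μ|) * l2Norm v.1 + l2Norm v.2.2) := by
  have heq : I.P.Aᵀ *ᵥ v.2.1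
      = (I.P.kkt v + μ • skew v) ∘ Sum.inr + (I.P.Q *ᵥ v.1 + μ • v.1) - v.2.2 := by
    ext i
    simp [QP.kkt, skew]
    ring
  have hprox : l2Norm (I.P.Q *ᵥ v.1 + μ • v.1) ≤ (K + |μ|) * l2Norm v.1 := by
    rw [add_mul, ← l2Norm_smul]
    exact (l2Norm_add_le _ _).trans (add_le_add_left (h.Q_le _) _)
  have hle : l2Norm (I.P.Aᵀ *ᵥ v.2.1)
      ≤ l2Norm (I.P.kkt v + μ • skew v) + (K + |μ|) * l2Norm v.1 + l2Norm v.2.2 := by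
    rw [heq]
    refine (l2Norm_sub_le _ _).trans (add_le_add_left ?_ _)
    exact (l2Norm_add_le _ _).trans (add_le_add (l2Norm_comp_inr_le _) hprox)
  exact (l2Norm_le_of_exists_mulVec_eq h.pos.le h.exists_preimage _).trans
    (mul_le_mul_of_nonneg_left hle h.pos.le)

lemma l2Norm_dual_le (v : PrimalDual n m) :
    l2Norm v.2.1 ≤ K * (l2Norm (I.P.kkt v) + K * l2Norm v.1 + l2Norm v.2.2) := by
  simpa using h.l2Norm_dual_le_add_smul v 0

lemma l2Norm_snd_snd_le (v : PrimalDual n m) :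
    l2Norm v.2.2 ≤ l2Norm (I.P.kkt v) + K * (l2Norm v.1 + l2Norm v.2.1) := by
  have heq : v.2.2 = I.P.kkt v ∘ Sum.inr + I.P.Q *ᵥ v.1 - I.P.Aᵀ *ᵥ v.2.1 := by
    ext i
    simp [QP.kkt]
    ring
  have hsum := (l2Norm_sub_le (I.P.kkt v ∘ Sum.inr + I.P.Q *ᵥ v.1) (I.P.Aᵀ *ᵥ v.2.1)).trans
    (add_le_add_left (l2Norm_add_le _ _) _)
  rw [← heq] at hsum
  linarith [l2Norm_comp_inr_le (I.P.kkt v), h.Q_le v.1, h.l2Norm_transpose_le v.2.1]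

lemma rbar_le : l2Norm I.rbar ≤ 5 * K ^ 2 * n := by
  have hρ : l2Norm (fun _ : Fin n => I.par.ρ) ≤ K * n :=
    l2Norm_le_mul_of_abs_le (by simp) h.pos.le fun _ => by
      rw [abs_of_pos h.ρ_pos]
      exact h.ρ_le
  have hkkt : l2Norm (I.P.kkt I.start.vec) ≤ K * (2 * (K * n) + K * n) + K * n :=
    (h.l2Norm_kkt_le _).trans <| add_le_add (mul_le_mul_of_nonneg_left
      (add_le_add (mul_le_mul_of_nonneg_left hρ zero_le_two) h.y0_le) h.pos.le) hρ
  have hsub : l2Norm I.rbar ≤ l2Norm (I.P.kkt I.start.vec) + l2Norm I.rhs := by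
    rw [eq_sub_of_add_eq' kkt_start.symm]
    exact l2Norm_sub_le _ _
  linarith [h.rhs_le, pow_mul_le_pow_mul h.one_le n.cast_nonneg (i := 1) (j := 2) (by simp)]

lemma exists_particular (r : Fin m ⊕ Fin n → ℝ) (μ : ℝ) :
    ∃ v, I.P.kkt v + μ • skew v = r ∧ v.2.1 = 0 ∧
    l2Norm v.1 ≤ K * l2Norm r ∧ l2Norm v.2.2 ≤ (1 + (K + |μ|) * K) * l2Norm r := by
  obtain ⟨x, hx, hxle⟩ := h.exists_preimage (r ∘ Sum.inl)
  replace hxle := hxle.trans (mul_le_mul_of_nonneg_left (l2Norm_comp_inl_le r) h.pos.le)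
  refine ⟨(x, 0, r ∘ Sum.inr + I.P.Q *ᵥ x + μ • x), ?_, rfl, hxle, ?_⟩
  · ext (i | i) <;> simp [QP.kkt, skew, hx]
    ring
  · have hsum := (l2Norm_add_le (r ∘ Sum.inr + I.P.Q *ᵥ x) (μ • x)).trans
      (add_le_add_left (l2Norm_add_le _ _) _)
    rw [l2Norm_smul] at hsum
    have hK := mul_le_mul_of_nonneg_left hxle (add_nonneg h.pos.le (abs_nonneg μ))
    linarith [h.Q_le x, l2Norm_comp_inr_le r]

lemma stackedSemiNorm_le (r : Fin m ⊕ Fin n → ℝ) :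
    I.P.stackedSemiNorm r ≤ 3 * K ^ 2 * l2Norm r := by
  obtain ⟨v, hv, -, hx, hz⟩ := h.exists_particular r 0
  rw [zero_smul, add_zero] at hv
  rw [abs_zero, add_zero] at hz
  have hsize : size v ≤ _ := l2Norm_sumElim_le v.1 v.2.2
  have hK1 := pow_mul_le_pow_mul h.one_le (l2Norm_nonneg r) (i := 0) (j := 2) (by simp)
  have hK2 := pow_mul_le_pow_mul h.one_le (l2Norm_nonneg r) (i := 1) (j := 2) (by simp)
  linarith [hv ▸ QP.stackedSemiNorm_kkt_le v]

lemma within_of_l2Norm_le {t : ℝ} {r : Fin m ⊕ Fin n → ℝ} (hr : 3 * K ^ 4 * l2Norm r ≤ t) :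
    I.Within t r := by
  have hr0 := l2Norm_nonneg r
  have hγρ : 1 ≤ (K * I.par.γA) * (K * I.par.ρ) :=
    one_le_mul_of_one_le_of_one_le h.one_le_mul_γA h.one_le_mul_ρ
  have hK2 : 0 ≤ 3 * K ^ 2 * l2Norm r := by positivity
  constructor
  · have hK3 : 0 ≤ 3 * K ^ 3 * l2Norm r := mul_nonneg (by have := h.pos; positivity) hr0
    calc l2Norm r ≤ 3 * K ^ 3 * l2Norm r := by
          linarith [pow_mul_le_pow_mul h.one_le hr0 (i := 0) (j := 3) (by simp)]
      _ ≤ 3 * K ^ 3 * l2Norm r * (K * I.par.CN) := le_mul_of_one_le_right hK3 h.one_le_mul_CN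
      _ = I.par.CN * (3 * K ^ 4 * l2Norm r) := by ring
      _ ≤ I.par.CN * t := mul_le_mul_of_nonneg_left hr h.CN_pos.le
  · calc I.P.stackedSemiNorm r ≤ 3 * K ^ 2 * l2Norm r := h.stackedSemiNorm_le r
      _ ≤ 3 * K ^ 2 * l2Norm r * ((K * I.par.γA) * (K * I.par.ρ)) := le_mul_of_one_le_right hK2 hγρ
      _ = I.par.γA * I.par.ρ * (3 * K ^ 4 * l2Norm r) := by ring
      _ ≤ I.par.γA * I.par.ρ * t :=
          mul_le_mul_of_nonneg_left hr (mul_nonneg h.γA_pos.le h.ρ_pos.le)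

end Bounded

end Instance

end DataBounds

section Iterates

open PrimalDual

variable {n m : ℕ} {K θ : ℝ} {I : Instance n m}

/-- A reference point at level `θ`: its entries are at least of order `θ`, while its complementarity
gap is at most of order `θ n`. Iterates with duality measure `θ μ₀` are compared with it. -/
structure IsReference (K θ : ℝ) (v : PrimalDual n m) : Prop where
  le_fst : ∀ i, θ ≤ 2 * K ^ 2 * v.1 i
  le_snd_snd : ∀ i, θ ≤ 2 * K ^ 2 * v.2.2 i
  dotProduct_le : v.1 ⬝ᵥ v.2.2 ≤ 4 * K ^ 2 * θ * n
  skew_le : l2Norm (skew v) ≤ 6 * K ^ 3 * n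

section ConvexCombination

variable {ι : Type*} [Fintype ι]

lemma le_mul_convexCombination (hθ : 0 ≤ θ) (hθ1 : θ ≤ 1) {a b : ℝ} (ha : 1 ≤ 2 * K ^ 2 * a)
    (hb : 0 ≤ b) : θ ≤ 2 * K ^ 2 * (θ * a + (1 - θ) * b) := by
  have hb' : 0 ≤ 2 * K ^ 2 * ((1 - θ) * b) :=
    mul_nonneg (by positivity) (mul_nonneg (sub_nonneg.2 hθ1) hb)
  linarith [mul_le_mul_of_nonneg_left ha hθ]

lemma l2Norm_convexCombination_le (hθ : 0 ≤ θ) (hθ1 : θ ≤ 1) {u v : ι → ℝ} {a b : ℝ}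
    (hu : l2Norm u ≤ a) (hv : l2Norm v ≤ b) :
    l2Norm (θ • u + (1 - θ) • v) ≤ θ * a + (1 - θ) * b := by
  have h := l2Norm_add_le (θ • u) ((1 - θ) • v)
  rw [l2Norm_smul, l2Norm_smul, abs_of_nonneg hθ, abs_of_nonneg (sub_nonneg.2 hθ1)] at h
  exact h.trans (add_le_add (mul_le_mul_of_nonneg_left hu hθ)
    (mul_le_mul_of_nonneg_left hv (sub_nonneg.2 hθ1)))

lemma dotProduct_le_mul_card {p q : ι → ℝ} {a b : ℝ} (hp : ∀ i, 0 ≤ p i ∧ p i ≤ a)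
    (hq : ∀ i, 0 ≤ q i ∧ q i ≤ b) : p ⬝ᵥ q ≤ a * b * Fintype.card ι := by
  have hle := Finset.sum_le_card_nsmul Finset.univ (fun i => p i * q i) (a * b) fun i _ =>
    mul_le_mul (hp i).2 (hq i).2 (hq i).1 ((hp i).1.trans (hp i).2)
  rwa [nsmul_eq_mul, mul_comm, Finset.card_univ] at hle

lemma convexCombination_dotProduct_le (hθ : 0 ≤ θ) (hθ1 : θ ≤ 1) {x z x' z' : ι → ℝ}
    (hx : ∀ i, 0 ≤ x i ∧ x i ≤ 2 * K) (hz : ∀ i, 0 ≤ z i ∧ z i ≤ 2 * K)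
    (hx' : ∀ i, 0 ≤ x' i ∧ x' i ≤ K) (hz' : ∀ i, 0 ≤ z' i ∧ z' i ≤ K) (hcompl : x' ⬝ᵥ z' = 0) :
    (θ • x + (1 - θ) • x') ⬝ᵥ (θ • z + (1 - θ) • z') ≤ 4 * K ^ 2 * θ * Fintype.card ι := by
  calc (θ • x + (1 - θ) • x') ⬝ᵥ (θ • z + (1 - θ) • z')
      = θ * θ * (x ⬝ᵥ z) + θ * (1 - θ) * (x ⬝ᵥ z' + x' ⬝ᵥ z) := by
        simp only [add_dotProduct, dotProduct_add, smul_dotProduct, dotProduct_smul, smul_eq_mul,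
          hcompl]
        ring
    _ ≤ θ * θ * (2 * K * (2 * K) * Fintype.card ι)
        + θ * (1 - θ) * (2 * K * K * Fintype.card ι + K * (2 * K) * Fintype.card ι) :=
        add_le_add
          (mul_le_mul_of_nonneg_left (dotProduct_le_mul_card hx hz) (mul_nonneg hθ hθ))
          (mul_le_mul_of_nonneg_left
            (add_le_add (dotProduct_le_mul_card hx hz') (dotProduct_le_mul_card hx' hz))
            (mul_nonneg hθ (sub_nonneg.2 hθ1)))
    _ = 4 * K ^ 2 * θ * Fintype.card ι := by ring

end ConvexCombination

lemma PrimalDual.l2Norm_skew_le (v : PrimalDual n m) :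
    l2Norm (skew v) ≤ l2Norm v.2.1 + l2Norm v.1 := by
  rw [← l2Norm_neg v.1]
  exact l2Norm_sumElim_le _ _

namespace Instance.Bounded

variable {r : Fin m ⊕ Fin n → ℝ} {vt vs : PrimalDual n m}

lemma add_start_mem_Icc (h : I.Bounded K) {e : ℝ} (he : |e| ≤ (1 + I.par.γA) / 2 * I.par.ρ) :
    1 ≤ 2 * K ^ 2 * (I.par.ρ + e) ∧ I.par.ρ + e ≤ 2 * K := by
  have hK := h.pos
  have hγρ : 1 ≤ (K * (1 - I.par.γA)) * (K * I.par.ρ) :=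
    one_le_mul_of_one_le_of_one_le h.one_le_mul_one_sub_γA h.one_le_mul_ρ
  obtain ⟨hlo, hhi⟩ := abs_le.1 he
  constructor
  · calc 1 ≤ (K * (1 - I.par.γA)) * (K * I.par.ρ) := hγρ
      _ = 2 * K ^ 2 * (I.par.ρ - (1 + I.par.γA) / 2 * I.par.ρ) := by ring
      _ ≤ 2 * K ^ 2 * (I.par.ρ + e) := mul_le_mul_of_nonneg_left (by linarith) (by positivity)
  · nlinarith [h.ρ_le, h.ρ_pos, h.γA_lt_one]

/-- The part of the seminorm bound with `γ_𝒜 < 1` keeps the shifted starting point positive. -/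
lemma exists_shifted_start (h : I.Bounded K) (hr : I.Within 1 r) :
    ∃ v, I.P.kkt v = I.rhs + I.rbar + r ∧
      (∀ i, (1 ≤ 2 * K ^ 2 * v.1 i ∧ v.1 i ≤ 2 * K) ∧
        1 ≤ 2 * K ^ 2 * v.2.2 i ∧ v.2.2 i ≤ 2 * K) ∧
      l2Norm v.2.1 ≤ 4 * K ^ 3 * n := by
  have hρ := h.ρ_pos
  have hlt : I.P.stackedSemiNorm r < (1 + I.par.γA) / 2 * I.par.ρ := by
    nlinarith [hr.2, h.γA_lt_one]
  obtain ⟨u, rfl, hu⟩ := QP.exists_kkt_eq_size_lt h.surjective hlt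
  have hx := l2Norm_fst_le_size u
  have hz := l2Norm_snd_snd_le_size u
  refine ⟨I.start.vec + u, by rw [map_add, kkt_start], fun i => ⟨?_, ?_⟩, ?_⟩
  · exact h.add_start_mem_Icc <| (abs_apply_le_l2Norm u.1 i).trans (hx.trans hu.le)
  · exact h.add_start_mem_Icc <| (abs_apply_le_l2Norm u.2.2 i).trans (hz.trans hu.le)
  · have hKu : size u ≤ K := hu.le.trans (by nlinarith [h.ρ_le, h.γA_lt_one])
    have hsum : l2Norm (I.P.kkt u) + K * l2Norm u.1 + l2Norm u.2.2 ≤ K + K * K + K :=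
      add_le_add (add_le_add ((hr.1.trans_eq (mul_one _)).trans h.CN_le)
        (mul_le_mul_of_nonneg_left (hx.trans hKu) h.pos.le)) (hz.trans hKu)
    have huy := (h.l2Norm_dual_le u).trans (mul_le_mul_of_nonneg_left hsum h.pos.le)
    have hadd : l2Norm (I.start.vec + u).2.1 ≤ K * n + K * (K + K * K + K) :=
      (l2Norm_add_le I.y0 u.2.1).trans (add_le_add h.y0_le huy)
    have hn := mul_le_mul_of_nonneg_left h.one_le_n (pow_nonneg h.pos.le 3)
    linarith [pow_mul_le_pow_mul h.one_le n.cast_nonneg (i := 1) (j := 3) (by simp),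
      pow_mul_le_pow_mul h.one_le zero_le_one (i := 2) (j := 3) (by simp)]

lemma isReference_convexCombination (h : I.Bounded K) (hθ : 0 ≤ θ) (hθ1 : θ ≤ 1)
    (ht : ∀ i, (1 ≤ 2 * K ^ 2 * vt.1 i ∧ vt.1 i ≤ 2 * K) ∧
      1 ≤ 2 * K ^ 2 * vt.2.2 i ∧ vt.2.2 i ≤ 2 * K)
    (hty : l2Norm vt.2.1 ≤ 4 * K ^ 3 * n)
    (hs : ∀ i, (0 ≤ vs.1 i ∧ vs.1 i ≤ K) ∧ 0 ≤ vs.2.2 i ∧ vs.2.2 i ≤ K)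
    (hcompl : vs.1 ⬝ᵥ vs.2.2 = 0) (hsy : l2Norm vs.2.1 ≤ K * n) :
    IsReference K θ (θ • vt + (1 - θ) • vs) where
  le_fst i := le_mul_convexCombination hθ hθ1 (ht i).1.1 (hs i).1.1
  le_snd_snd i := le_mul_convexCombination hθ hθ1 (ht i).2.1 (hs i).2.1
  dotProduct_le := by
    have hnonneg {a : ℝ} (ha : 1 ≤ 2 * K ^ 2 * a) : 0 ≤ a :=
      (pos_of_mul_pos_right (zero_lt_one.trans_le ha) (by positivity)).le
    simpa using convexCombination_dotProduct_le hθ hθ1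
      (fun i => ⟨hnonneg (ht i).1.1, (ht i).1.2⟩) (fun i => ⟨hnonneg (ht i).2.1, (ht i).2.2⟩)
      (fun i => (hs i).1) (fun i => (hs i).2) hcompl
  skew_le := by
    have hK := h.pos
    have hn : (0 : ℝ) ≤ n := n.cast_nonneg
    have hx : l2Norm (θ • vt + (1 - θ) • vs).1 ≤ θ * (2 * K * n) + (1 - θ) * (2 * K * n) := by
      refine l2Norm_convexCombination_le hθ hθ1 ?_ ?_ <;>
        refine l2Norm_le_mul_of_abs_le (by simp) (by linarith) fun i => abs_le.2 ?_
      · exact ⟨by nlinarith [(ht i).1.1], (ht i).1.2⟩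
      · exact ⟨by linarith [(hs i).1.1], by linarith [(hs i).1.2]⟩
    have hy : l2Norm (θ • vt + (1 - θ) • vs).2.1 ≤ θ * (4 * K ^ 3 * n) + (1 - θ) * (K * n) :=
      l2Norm_convexCombination_le hθ hθ1 hty hsy
    have hK3 : K * n ≤ K ^ 3 * n := by
      linarith [pow_mul_le_pow_mul h.one_le hn (i := 1) (j := 3) (by simp)]
    have hlast : (1 - θ) * (K * n) ≤ (1 - θ) * (4 * K ^ 3 * n) :=
      mul_le_mul_of_nonneg_left (by linarith [mul_nonneg hK.le hn]) (sub_nonneg.2 hθ1)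
    linarith [l2Norm_skew_le (θ • vt + (1 - θ) • vs)]

lemma exists_isReference (h : I.Bounded K) (hθ : 0 < θ) (hθ1 : θ ≤ 1) (hr : I.Within θ r) :
    ∃ v, I.P.kkt v = I.rhs + θ • I.rbar + r ∧ IsReference K θ v := by
  have hr1 := hr.smul h.surjective (inv_nonneg.2 hθ.le)
  rw [inv_mul_cancel₀ hθ.ne'] at hr1
  obtain ⟨vt, hvt, ht, hty⟩ := h.exists_shifted_start hr1
  obtain ⟨vs, hvs, hs, hcompl, hsy⟩ := h.exists_solution
  refine ⟨θ • vt + (1 - θ) • vs, ?_,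
    h.isReference_convexCombination hθ.le hθ1 ht hty hs hcompl hsy⟩
  rw [map_add, map_smul, map_smul, hvt, hvs, smul_add, smul_add, smul_inv_smul₀ hθ.ne']
  module

end Instance.Bounded

lemma IsReference.fundamental_estimate {v w : PrimalDual n m} (h : I.Bounded K)
    (hv : IsReference K θ v) (hθ : 0 < θ) {g : Fin m ⊕ Fin n → ℝ}
    (hkkt : I.P.kkt v = I.P.kkt w + (θ * I.mu0) • g) (hx : 0 ≤ w.1) (hz : 0 ≤ w.2.2)
    (hμ : w.1 ⬝ᵥ w.2.2 = n * (θ * I.mu0)) :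
    ∑ i, w.1 i + ∑ i, w.2.2 i + 2 * K ^ 2 * I.mu0 * (g ⬝ᵥ (skew w - skew v))
      ≤ 10 * K ^ 4 * n := by
  have hmono := QP.neg_kkt_dotProduct_skew_le h.Q_posSemidef (w - v)
  have hlevel : ∀ {p q : Fin n → ℝ}, (∀ i, θ ≤ 2 * K ^ 2 * p i) → 0 ≤ q →
      θ * ∑ i, q i ≤ 2 * K ^ 2 * (p ⬝ᵥ q) := by
    intro p q hp hq
    rw [dotProduct, Finset.mul_sum, Finset.mul_sum]
    refine Finset.sum_le_sum fun i _ => ?_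
    rw [← mul_assoc]
    exact mul_le_mul_of_nonneg_right (hp i) (hq i)
  have hsx := hlevel hv.le_snd_snd hx
  have hsz := hlevel hv.le_fst hz
  rw [map_sub, map_sub, hkkt, sub_add_cancel_left, neg_dotProduct, neg_neg, smul_dotProduct,
    smul_eq_mul] at hmono
  have hexp : (w - v).1 ⬝ᵥ (w - v).2.2
      = n * (θ * I.mu0) - v.2.2 ⬝ᵥ w.1 - v.1 ⬝ᵥ w.2.2 + v.1 ⬝ᵥ v.2.2 := by
    rw [Prod.fst_sub, Prod.snd_sub, Prod.snd_sub, sub_dotProduct, dotProduct_sub, dotProduct_sub,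
      hμ, dotProduct_comm v.2.2]
    ring
  rw [hexp] at hmono
  refine le_of_mul_le_mul_left ?_ hθ
  have hμ0 := mul_le_mul_of_nonneg_left h.mu0_le (by positivity : 0 ≤ 2 * K ^ 2 * θ * n)
  have hgap := mul_le_mul_of_nonneg_left hv.dotProduct_le (by positivity : 0 ≤ 2 * K ^ 2)
  have hscaled := mul_le_mul_of_nonneg_left hmono (by positivity : 0 ≤ 2 * K ^ 2)
  linarith

end Iterates

section IterateBounds

open PrimalDual

variable {n m : ℕ} {K : ℝ} {I : Instance n m} {w : Triple n m} {a : Fin m ⊕ Fin n → ℝ}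

namespace Instance

/-- `w` lies in its neighborhood `𝒩_μ` with stacked anchor `a`, and `0 < μ ≤ μ₀` for its duality
measure `μ`. -/
structure IsIterate (I : Instance n m) (a : Fin m ⊕ Fin n → ℝ) (w : Triple n m) : Prop where
  mu_pos : 0 < w.mu
  mu_le : w.mu ≤ I.mu0
  within : I.Within (w.mu / I.mu0) (I.deviation w.mu a w.vec)
  x_pos : ∀ i, 0 < w.x i
  z_pos : ∀ i, 0 < w.z i
  central : ∀ i, I.par.γμ * w.mu ≤ w.x i * w.z i

/-- An iterate that is bounded by `K n`. -/
structure IsBoundedIterate (I : Instance n m) (K : ℝ) (a : Fin m ⊕ Fin n → ℝ) (w : Triple n m) :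
    Prop extends IsIterate I a w where
  x_le : l2Norm w.x ≤ K * n
  z_le : l2Norm w.z ≤ K * n
  gap_le : l2Norm (skew w.vec - a) ≤ K * n

lemma isIterate_anchor_iff (h : I.Bounded K) {ζ : Fin n → ℝ} {lam : Fin m → ℝ} :
    I.IsIterate (anchor ζ lam) w ↔ (0 < w.mu ∧ w.mu ≤ I.mu0) ∧ w ∈ I.nbhd w.mu ζ lam := by
  constructor
  · exact fun hw => ⟨⟨hw.mu_pos, hw.mu_le⟩, (mem_nbhd_iff h.surjective h.mu0_pos hw.mu_pos).2
      ⟨hw.within, fun i => ⟨hw.x_pos i, hw.z_pos i, hw.central i⟩⟩⟩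
  · rintro ⟨⟨hpos, hle⟩, hw⟩
    obtain ⟨hdev, hw⟩ := (mem_nbhd_iff h.surjective h.mu0_pos hpos).1 hw
    exact ⟨hpos, hle, hdev, fun i => (hw i).1, fun i => (hw i).2.1, fun i => (hw i).2.2⟩

end Instance

lemma PrimalDual.l2Norm_fst_le_skew (v : PrimalDual n m) : l2Norm v.1 ≤ l2Norm (skew v) := by
  rw [← l2Norm_neg v.1]
  exact l2Norm_comp_inr_le (skew v)

lemma PrimalDual.l2Norm_snd_fst_le_skew (v : PrimalDual n m) : l2Norm v.2.1 ≤ l2Norm (skew v) :=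
  l2Norm_comp_inl_le (skew v)

lemma l2Norm_sq_le_two_mul_dotProduct_add {ι : Type*} [Fintype ι] (u v : ι → ℝ) :
    l2Norm u ^ 2 ≤ 2 * (u ⬝ᵥ v) + l2Norm (u - v) ^ 2 := by
  have hv := sq_nonneg (l2Norm v)
  rw [l2Norm_sq] at hv
  rw [l2Norm_sq, l2Norm_sq, sub_dotProduct, dotProduct_sub, dotProduct_sub, dotProduct_comm v u]
  linarith

namespace Instance

namespace IsIterate

section

variable (hw : I.IsIterate a w) (h : I.Bounded K)

include hw h

lemma div_mu0_pos : 0 < w.mu / I.mu0 := div_pos hw.mu_pos h.mu0_pos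

lemma div_mu0_le_one : w.mu / I.mu0 ≤ 1 := (div_le_one h.mu0_pos).2 hw.mu_le

lemma sum_add_sum_add_le :
    ∃ v : PrimalDual n m, l2Norm (skew v) ≤ 6 * K ^ 3 * n ∧
      ∑ i, w.x i + ∑ i, w.z i
        + 2 * K ^ 2 * I.mu0 * ((skew w.vec - a) ⬝ᵥ (skew w.vec - skew v)) ≤ 10 * K ^ 4 * n := by
  obtain ⟨v, hv, href⟩ := h.exists_isReference (hw.div_mu0_pos h) (hw.div_mu0_le_one h) hw.within
  have hμ : w.mu / I.mu0 * I.mu0 = w.mu := div_mul_cancel₀ _ h.mu0_pos.ne'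
  have hn : (n : ℝ) ≠ 0 := Nat.cast_ne_zero.2 h.n_pos.ne'
  refine ⟨v, href.skew_le, href.fundamental_estimate h (hw.div_mu0_pos h) (w := w.vec) ?_
    (fun i => (hw.x_pos i).le) (fun i => (hw.z_pos i).le) ?_⟩
  · rw [hv, deviation, hμ]
    module
  · rw [hμ]
    exact (mul_div_cancel₀ _ hn).symm

lemma l2Norm_deviation_le : l2Norm (I.deviation w.mu a w.vec) ≤ K * (w.mu / I.mu0) :=
  hw.within.1.trans (mul_le_mul_of_nonneg_right h.CN_le (hw.div_mu0_pos h).le)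

lemma l2Norm_kkt_add_le :
    l2Norm (I.P.kkt w.vec + w.mu • (skew w.vec - a)) ≤ 7 * K ^ 2 * n := by
  have hθ := (hw.div_mu0_pos h).le
  have heq : I.P.kkt w.vec + w.mu • (skew w.vec - a)
      = I.deviation w.mu a w.vec + I.rhs + (w.mu / I.mu0) • I.rbar := by
    rw [deviation]
    module
  have hsum := (l2Norm_add_le (I.deviation w.mu a w.vec + I.rhs) ((w.mu / I.mu0) • I.rbar)).trans
    (add_le_add_left (l2Norm_add_le _ _) _)
  rw [← heq, l2Norm_smul, abs_of_nonneg hθ] at hsum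
  have hrbar := mul_le_of_le_one_left (l2Norm_nonneg I.rbar) (hw.div_mu0_le_one h)
  have hdev := (hw.l2Norm_deviation_le h).trans
    (mul_le_of_le_one_right h.pos.le (hw.div_mu0_le_one h))
  have hKn := mul_le_mul_of_nonneg_left h.one_le_n h.pos.le
  linarith [h.rbar_le, h.rhs_le,
    pow_mul_le_pow_mul h.one_le n.cast_nonneg (i := 1) (j := 2) (by simp)]

end

/-- With its own position as anchor, the proximal terms vanish, and so does the scalar product in
the fundamental estimate. -/
lemma l2Norm_anchor_le (hw : I.IsIterate (anchor w.x w.y) w) (h : I.Bounded K) :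
    l2Norm (anchor w.x w.y) ≤ 40 * K ^ 6 * n := by
  have ha : skew w.vec - anchor w.x w.y = 0 := sub_self _
  obtain ⟨v, -, hsum⟩ := hw.sum_add_sum_add_le h
  rw [ha, zero_dotProduct, mul_zero, add_zero] at hsum
  have hkkt := hw.l2Norm_kkt_add_le h
  rw [ha, smul_zero, add_zero] at hkkt
  have hx := l2Norm_le_sum fun i => (hw.x_pos i).le
  have hz := l2Norm_le_sum fun i => (hw.z_pos i).le
  have hx' : l2Norm w.x ≤ 10 * K ^ 4 * n := by linarith [l2Norm_nonneg w.z]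
  have hz' : l2Norm w.z ≤ 10 * K ^ 4 * n := by linarith [l2Norm_nonneg w.x]
  have hdual : l2Norm w.y ≤ K * (7 * K ^ 2 * n + K * (10 * K ^ 4 * n) + 10 * K ^ 4 * n) :=
    (h.l2Norm_dual_le w.vec).trans <| mul_le_mul_of_nonneg_left
      (add_le_add (add_le_add hkkt (mul_le_mul_of_nonneg_left hx' h.pos.le)) hz') h.pos.le
  have hskew : l2Norm (anchor w.x w.y) ≤ l2Norm w.y + l2Norm w.x := l2Norm_skew_le w.vec
  have hpow {i : ℕ} (hi : i ≤ 6) := pow_mul_le_pow_mul h.one_le (n.cast_nonneg (α := ℝ)) hi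
  linarith [hpow (i := 0) (by simp), hpow (i := 3) (by simp), hpow (i := 4) (by simp),
    hpow (i := 5) (by simp), n.cast_nonneg (α := ℝ)]

lemma l2Norm_gap_le (hw : I.IsIterate a w) (h : I.Bounded K) (ha : l2Norm a ≤ 40 * K ^ 6 * n) :
    l2Norm (skew w.vec - a) ≤ 47 * K ^ 6 * n := by
  obtain ⟨v, hv, hsum⟩ := hw.sum_add_sum_add_le h
  have hn := h.one_le_n
  have hX : 1 ≤ K ^ 6 * n := one_le_mul_of_one_le_of_one_le (one_le_pow₀ h.one_le) hn
  have hdist : l2Norm (skew v - a) ≤ 46 * (K ^ 6 * n) := by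
    linarith [l2Norm_sub_le (skew v) a,
      pow_mul_le_pow_mul h.one_le n.cast_nonneg (i := 3) (j := 6) (by simp)]
  have hT : (skew w.vec - a) ⬝ᵥ (skew w.vec - skew v) ≤ 5 * (K ^ 6 * n) := by
    have hx := Finset.sum_nonneg fun i (_ : i ∈ Finset.univ) => (hw.x_pos i).le
    have hz := Finset.sum_nonneg fun i (_ : i ∈ Finset.univ) => (hw.z_pos i).le
    have hK := pow_mul_le_pow_mul h.one_le n.cast_nonneg (i := 4) (j := 6) (by simp)
    by_contra! hlt
    nlinarith [mul_le_mul_of_nonneg_right h.one_le_mul_mu0 (hlt.le.trans' (by linarith))]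
  have hsq := l2Norm_sq_le_two_mul_dotProduct_add (skew w.vec - a) (skew w.vec - skew v)
  rw [sub_sub_sub_cancel_left] at hsq
  refine le_of_sq_le_sq ?_ (by linarith)
  have hdist2 := pow_le_pow_left₀ (l2Norm_nonneg _) hdist 2
  nlinarith

lemma l2Norm_skew_vec_le (hw : I.IsIterate a w) (h : I.Bounded K)
    (ha : l2Norm a ≤ 40 * K ^ 6 * n) : l2Norm (skew w.vec) ≤ 87 * K ^ 6 * n := by
  have hadd := l2Norm_add_le (skew w.vec - a) a
  rw [sub_add_cancel] at hadd
  linarith [hw.l2Norm_gap_le h ha]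

lemma l2Norm_z_le (hw : I.IsIterate a w) (h : I.Bounded K) (ha : l2Norm a ≤ 40 * K ^ 6 * n) :
    l2Norm w.z ≤ 230 * K ^ 8 * n := by
  have hgap := hw.l2Norm_gap_le h ha
  have hskew := hw.l2Norm_skew_vec_le h ha
  have hx : l2Norm w.x ≤ l2Norm (skew w.vec) := l2Norm_fst_le_skew w.vec
  have hy : l2Norm w.y ≤ l2Norm (skew w.vec) := l2Norm_snd_fst_le_skew w.vec
  have hprox : l2Norm (w.mu • (skew w.vec - a)) ≤ K ^ 2 * (47 * K ^ 6 * n) := by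
    rw [l2Norm_smul, abs_of_pos hw.mu_pos]
    exact mul_le_mul (hw.mu_le.trans h.mu0_le) hgap (l2Norm_nonneg _) (sq_nonneg K)
  have hkkt := l2Norm_sub_le (I.P.kkt w.vec + w.mu • (skew w.vec - a)) (w.mu • (skew w.vec - a))
  rw [add_sub_cancel_right] at hkkt
  have hxy : K * (l2Norm w.x + l2Norm w.y) ≤ K * (2 * (87 * K ^ 6 * n)) :=
    mul_le_mul_of_nonneg_left (by linarith) h.pos.le
  have hpow {i : ℕ} (hi : i ≤ 8) := pow_mul_le_pow_mul h.one_le (n.cast_nonneg (α := ℝ)) hi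
  have hz : l2Norm w.z ≤ l2Norm (I.P.kkt w.vec) + K * (l2Norm w.x + l2Norm w.y) :=
    h.l2Norm_snd_snd_le w.vec
  linarith [hw.l2Norm_kkt_add_le h, hpow (i := 0) (by simp), hpow (i := 2) (by simp),
    hpow (i := 7) (by simp), n.cast_nonneg (α := ℝ)]

lemma isBoundedIterate (hw : I.IsIterate a w) (h : I.Bounded K)
    (ha : l2Norm a ≤ 40 * K ^ 6 * n) : I.IsBoundedIterate (230 * K ^ 8) a w where
  toIsIterate := hw
  x_le := by
    have hx : l2Norm w.x ≤ l2Norm (skew w.vec) := l2Norm_fst_le_skew w.vec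
    linarith [hw.l2Norm_skew_vec_le h ha, l2Norm_nonneg w.x,
      pow_mul_le_pow_mul h.one_le n.cast_nonneg (i := 6) (j := 8) (by simp)]
  z_le := hw.l2Norm_z_le h ha
  gap_le := by
    linarith [hw.l2Norm_gap_le h ha, l2Norm_nonneg (skew w.vec - a),
      pow_mul_le_pow_mul h.one_le n.cast_nonneg (i := 6) (j := 8) (by simp)]

end IsIterate

lemma isIterate_start (h : I.Bounded K) : I.IsIterate (anchor I.start.x I.start.y) I.start where
  mu_pos := h.mu0_pos
  mu_le := le_rfl
  within := by
    have hdev : I.deviation I.start.mu (anchor I.start.x I.start.y) I.start.vec = 0 := by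
      have hθ : I.start.mu / I.mu0 = 1 := div_self h.mu0_pos.ne'
      have ha : anchor I.start.x I.start.y = skew I.start.vec := rfl
      rw [deviation, hθ, kkt_start, ha]
      module
    rw [hdev]
    refine h.within_of_l2Norm_le ?_
    rw [l2Norm_zero, mul_zero]
    exact (div_pos h.mu0_pos h.mu0_pos).le
  x_pos _ := h.ρ_pos
  z_pos _ := h.ρ_pos
  central _ := by
    have hle : I.par.γμ * I.mu0 ≤ I.mu0 := mul_le_of_le_one_left h.mu0_pos.le h.γμ_lt_one.le
    exact hle.trans_eq (h.mu0_eq.trans (sq _))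

end Instance

end IterateBounds

section DirectionBounds

open PrimalDual

lemma abs_mul_le_scaled {x z p q : ℝ} (hx : 0 < x) (hz : 0 < z) :
    |p * q| ≤ z * p ^ 2 / x + x * q ^ 2 / z := by
  have hp : 0 ≤ z * p ^ 2 / x := by positivity
  have hq : 0 ≤ x * q ^ 2 / z := by positivity
  have hpq : (p * q) ^ 2 = (z * p ^ 2 / x) * (x * q ^ 2 / z) := by
    field_simp
  refine abs_le_of_sq_le_sq ?_ (add_nonneg hp hq)
  rw [hpq]
  linarith [sq_nonneg (z * p ^ 2 / x), sq_nonneg (x * q ^ 2 / z), mul_nonneg hp hq]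

lemma abs_le_mul_of_scaled_le {x z e μ K c : ℝ} (hx : 0 < x) (hz : 0 < z) (hc : 0 ≤ c)
    (hμ : μ ≤ K * (x * z)) (he : z * e ^ 2 / x ≤ c * μ) {b : ℝ} (hb : 0 ≤ b) (hcb : c * K ≤ b ^ 2) :
    |e| ≤ b * x := by
  refine abs_le_of_sq_le_sq (le_of_mul_le_mul_left ?_ hz) (mul_nonneg hb hx.le)
  calc z * e ^ 2 ≤ c * μ * x := (div_le_iff₀ hx).1 he
    _ ≤ c * (K * (x * z)) * x :=
        mul_le_mul_of_nonneg_right (mul_le_mul_of_nonneg_left hμ hc) hx.le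
    _ = z * (c * K * x ^ 2) := by ring
    _ ≤ z * (b * x) ^ 2 := by
        rw [mul_pow]
        exact mul_le_mul_of_nonneg_left (mul_le_mul_of_nonneg_right hcb (sq_nonneg x)) hz.le

lemma sq_mul_add_sq_mul_le (x z p q a b c : ℝ) (h : z * p + x * q = c) :
    (z * p) ^ 2 + (x * q) ^ 2
      ≤ 6 * c ^ 2 + 8 * ((z * a) ^ 2 + (x * b) ^ 2) - 4 * ((p - a) * (q - b)) * (x * z) := by
  have hsum : z * (p - a) + x * (q - b) = c - z * a - x * b := by rw [← h]; ring
  have hsq : (z * (p - a) + x * (q - b)) ^ 2 ≤ 3 * (c ^ 2 + (z * a) ^ 2 + (x * b) ^ 2) := by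
    rw [hsum]
    linarith [sq_nonneg (c + z * a), sq_nonneg (c + x * b), sq_nonneg (z * a - x * b)]
  linarith [sq_nonneg (z * (p - a) - z * a), sq_nonneg (x * (q - b) - x * b)]

/-- Weighting by `√(z / x)` and `√(x / z)` turns the complementarity equation into an orthogonality
relation between `p - a` and `q - b`, up to the nonnegative term `(p - a) (q - b)`. -/
lemma scaled_le_of_compl {x z p q a b K μ σ : ℝ} (hx : 0 < x) (hz : 0 < z) (hμ : 0 < μ)
    (hσ : 0 ≤ σ) (hσ1 : σ ≤ 1) (hxz : μ ≤ K * (x * z)) (h : z * p + x * q = σ * μ - x * z) :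
    z * p ^ 2 / x + x * q ^ 2 / z ≤ 6 * (x * z + K * μ)
      + 8 * (K / μ) * (z ^ 2 * a ^ 2 + x ^ 2 * b ^ 2) - 4 * ((p - a) * (q - b)) := by
  have hxz0 : 0 < x * z := mul_pos hx hz
  have hσμ : σ * μ ≤ μ := mul_le_of_le_one_left hμ.le hσ1
  have hsq : (σ * μ - x * z) ^ 2 ≤ (x * z + K * μ) * (x * z) := by
    nlinarith [mul_nonneg hσ hμ.le]
  have hK : 1 ≤ K / μ * (x * z) := by
    rwa [div_mul_eq_mul_div, one_le_div hμ]
  have hab : (z * a) ^ 2 + (x * b) ^ 2 ≤ K / μ * ((z * a) ^ 2 + (x * b) ^ 2) * (x * z) := by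
    rw [mul_right_comm]
    exact le_mul_of_one_le_left (by positivity) hK
  have heq : z * p ^ 2 / x + x * q ^ 2 / z = ((z * p) ^ 2 + (x * q) ^ 2) / (x * z) := by
    field_simp
  rw [heq, div_le_iff₀ hxz0]
  linarith [sq_mul_add_sq_mul_le x z p q a b _ h]

lemma sum_scaled_le_of_compl {ι : Type*} [Fintype ι] {x z p q a b : ι → ℝ} {K μ σ : ℝ}
    (hx : ∀ i, 0 < x i) (hz : ∀ i, 0 < z i) (hμ : 0 < μ) (hσ : 0 ≤ σ) (hσ1 : σ ≤ 1)
    (hxz : ∀ i, μ ≤ K * (x i * z i)) (h : ∀ i, z i * p i + x i * q i = σ * μ - x i * z i) :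
    ∑ i, (z i * p i ^ 2 / x i + x i * q i ^ 2 / z i)
      ≤ 6 * (x ⬝ᵥ z + Fintype.card ι * (K * μ))
        + 8 * (K / μ) * (∑ i, z i ^ 2 * a i ^ 2 + ∑ i, x i ^ 2 * b i ^ 2)
        - 4 * ((p - a) ⬝ᵥ (q - b)) := by
  refine (Finset.sum_le_sum fun i _ => scaled_le_of_compl (hx i) (hz i) hμ hσ hσ1 (hxz i) (h i)
    (a := a i) (b := b i)).trans_eq ?_
  simp only [dotProduct, Finset.sum_add_distrib, Finset.sum_sub_distrib, Finset.mul_sum, mul_add,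
    Finset.sum_const, Finset.card_univ, nsmul_eq_mul, Pi.sub_apply]
  ring

lemma sum_sq_mul_sq_le {ι : Type*} [Fintype ι] (u v : ι → ℝ) :
    ∑ i, u i ^ 2 * v i ^ 2 ≤ l2Norm u ^ 2 * l2Norm v ^ 2 := by
  rw [l2Norm_sq u, dotProduct, Finset.sum_mul]
  refine Finset.sum_le_sum fun i _ => ?_
  rw [← sq]
  exact mul_le_mul_of_nonneg_left (sq_apply_le_l2Norm_sq v i) (sq_nonneg _)

variable {n m : ℕ} {K σ : ℝ} {I : Instance n m} {w : Triple n m} {a r : Fin m ⊕ Fin n → ℝ}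
  {d : PrimalDual n m}

/-- The direction `d` is, relative to the point `w` and its duality measure, of the order of the
powers of `n` that the analysis of the stepsize needs. -/
structure IsBoundedDirection (K : ℝ) (w : Triple n m) (d : PrimalDual n m) : Prop where
  abs_fst_le : ∀ i, |d.1 i| ≤ K * n ^ 2 * w.x i
  abs_snd_snd_le : ∀ i, |d.2.2 i| ≤ K * n ^ 2 * w.z i
  abs_mul_le : ∀ i, |d.1 i * d.2.2 i| ≤ K * n ^ 4 * w.mu
  abs_dotProduct_le : |d.1 ⬝ᵥ d.2.2| ≤ K * n ^ 4 * w.mu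
  skew_le : l2Norm (skew d) ≤ K * n ^ 3

namespace Instance

lemma Bounded.mu_le_mul (h : I.Bounded K) (hw : I.IsIterate a w) (i : Fin n) :
    w.mu ≤ K * (w.x i * w.z i) := by
  linarith [mul_le_mul_of_nonneg_right h.one_le_mul_γμ hw.mu_pos.le,
    mul_le_mul_of_nonneg_left (hw.central i) h.pos.le]

lemma Bounded.dotProduct_eq (h : I.Bounded K) (w : Triple n m) : w.x ⬝ᵥ w.z = n * w.mu :=
  (mul_div_cancel₀ _ (Nat.cast_ne_zero.2 h.n_pos.ne')).symm

lemma Bounded.div_mu0_le (h : I.Bounded K) (hw : I.IsIterate a w) :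
    w.mu / I.mu0 ≤ K ^ 2 * w.mu := by
  rw [div_le_iff₀ h.mu0_pos]
  linarith [mul_le_mul_of_nonneg_left h.one_le_mul_mu0 hw.mu_pos.le]

namespace IsNewtonDirection

variable (hd : I.IsNewtonDirection a w σ r d) (h : I.Bounded K)

include hd h

lemma σ_pos : 0 < σ := h.σmin_pos.trans_le hd.σmin_le

lemma σ_le : σ ≤ 1 / 2 := hd.le_σmax.trans h.valid.1.2.2

lemma l2Norm_residual_le (hw : I.IsIterate a w) : l2Norm r ≤ K * (w.mu / I.mu0) := by
  have hθ := hw.div_mu0_pos h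
  have hσ : I.par.σmin / 4 * (w.mu / I.mu0) ≤ w.mu / I.mu0 :=
    mul_le_of_le_one_left hθ.le (by linarith [hd.σmin_le, hd.σ_le h])
  exact hd.within.1.trans (mul_le_mul h.CN_le hσ
    (mul_nonneg (by linarith [h.σmin_pos]) hθ.le) h.pos.le)

lemma l2Norm_kkt_add_le (hw : I.IsBoundedIterate K a w) :
    l2Norm (I.P.kkt d + w.mu • skew d) ≤ 8 * K ^ 4 * n * w.mu := by
  have hθ := hw.div_mu0_pos h
  have hσ := hd.σ_pos h
  have hσ1 : 0 ≤ 1 - σ := by linarith [hd.σ_le h]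
  have heq : I.P.kkt d + w.mu • skew d = (r - I.deviation w.mu a w.vec)
      + (((1 - σ) * w.mu) • (skew w.vec - a) - ((1 - σ) * (w.mu / I.mu0)) • I.rbar) := by
    rw [hd.kkt_add, deviation_mul]
    abel
  have hres : l2Norm (r - I.deviation w.mu a w.vec) ≤ _ :=
    (l2Norm_sub_le _ _).trans
      (add_le_add (hd.l2Norm_residual_le h hw.toIsIterate) (hw.l2Norm_deviation_le h))
  have hprox : l2Norm (((1 - σ) * w.mu) • (skew w.vec - a)) ≤ w.mu * (K * n) := by
    rw [l2Norm_smul, abs_of_nonneg (mul_nonneg hσ1 hw.mu_pos.le)]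
    exact mul_le_mul (mul_le_of_le_one_left hw.mu_pos.le (by linarith)) hw.gap_le
      (l2Norm_nonneg _) hw.mu_pos.le
  have hrbar : l2Norm (((1 - σ) * (w.mu / I.mu0)) • I.rbar) ≤ w.mu / I.mu0 * (5 * K ^ 2 * n) := by
    rw [l2Norm_smul, abs_of_nonneg (mul_nonneg hσ1 hθ.le)]
    exact mul_le_mul (mul_le_of_le_one_left hθ.le (by linarith)) h.rbar_le
      (l2Norm_nonneg _) hθ.le
  have hlevel := mul_le_mul_of_nonneg_right (h.div_mu0_le hw.toIsIterate)
    (by have := h.pos; positivity : 0 ≤ 2 * K + 5 * K ^ 2 * n)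
  have hμn : 0 ≤ n * w.mu := mul_nonneg n.cast_nonneg hw.mu_pos.le
  have hone := mul_le_mul_of_nonneg_left h.one_le_n
    (mul_nonneg (pow_nonneg h.pos.le 3) hw.mu_pos.le)
  rw [heq]
  linarith [l2Norm_add_le (r - I.deviation w.mu a w.vec)
      (((1 - σ) * w.mu) • (skew w.vec - a) - ((1 - σ) * (w.mu / I.mu0)) • I.rbar),
    l2Norm_sub_le (((1 - σ) * w.mu) • (skew w.vec - a)) (((1 - σ) * (w.mu / I.mu0)) • I.rbar),
    pow_mul_le_pow_mul h.one_le hμn (i := 1) (j := 4) (by simp),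
    pow_mul_le_pow_mul h.one_le hμn (i := 3) (j := 4) (by simp)]

/-- Monotonicity: `d` and any other solution of the linear part of the Newton system form a
nonnegative pair. -/
lemma exists_comparison (hw : I.IsBoundedIterate K a w) : ∃ v : PrimalDual n m,
    0 ≤ (d - v).1 ⬝ᵥ (d - v).2.2 ∧
    l2Norm v.1 ≤ 24 * K ^ 7 * n * w.mu ∧ l2Norm v.2.2 ≤ 24 * K ^ 7 * n * w.mu := by
  obtain ⟨v, hv, -, hx, hz⟩ := h.exists_particular (I.P.kkt d + w.mu • skew d) w.mu
  have hR := hd.l2Norm_kkt_add_le h hw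
  have hμn : 0 ≤ n * w.mu := mul_nonneg n.cast_nonneg hw.mu_pos.le
  refine ⟨v, ?_, ?_, ?_⟩
  · have hkkt : I.P.kkt (d - v) = -(w.mu • skew (d - v)) := by
      rw [map_sub, map_sub, eq_sub_of_add_eq hv]
      module
    have hmono := QP.neg_kkt_dotProduct_skew_le h.Q_posSemidef (d - v)
    rw [hkkt, neg_dotProduct, neg_neg, smul_dotProduct, ← l2Norm_sq] at hmono
    exact (mul_nonneg hw.mu_pos.le (sq_nonneg _)).trans hmono
  · have := mul_le_mul_of_nonneg_left hR h.pos.le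
    linarith [mul_nonneg (pow_nonneg h.pos.le 5) hμn,
      pow_mul_le_pow_mul h.one_le hμn (i := 5) (j := 7) (by simp)]
  · have hcoeff : 1 + (K + |w.mu|) * K ≤ 3 * K ^ 3 := by
      rw [abs_of_pos hw.mu_pos]
      nlinarith [hw.mu_le.trans h.mu0_le, h.one_le, h.pos,
        pow_le_pow_right₀ h.one_le (show 0 ≤ 3 by simp),
        pow_le_pow_right₀ h.one_le (show 2 ≤ 3 by simp)]
    have := h.pos
    calc l2Norm v.2.2 ≤ 3 * K ^ 3 * (8 * K ^ 4 * n * w.mu) :=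
          hz.trans (mul_le_mul hcoeff hR (l2Norm_nonneg _) (by positivity))
      _ = 24 * K ^ 7 * n * w.mu := by ring

lemma sum_scaled_le (hw : I.IsBoundedIterate K a w) :
    ∑ i, (w.z i * d.1 i ^ 2 / w.x i + w.x i * d.2.2 i ^ 2 / w.z i)
      ≤ 9300 * K ^ 17 * n ^ 4 * w.mu := by
  obtain ⟨v, hmono, hvx, hvz⟩ := hd.exists_comparison h hw
  have hμ := hw.mu_pos
  have hK := h.pos
  have hprod {u u' : Fin n → ℝ} (hu : l2Norm u ≤ K * n) (hu' : l2Norm u' ≤ 24 * K ^ 7 * n * w.mu) :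
      ∑ i, u i ^ 2 * u' i ^ 2 ≤ (K * n) ^ 2 * (24 * K ^ 7 * n * w.mu) ^ 2 :=
    (sum_sq_mul_sq_le u u').trans <| mul_le_mul
      (pow_le_pow_left₀ (l2Norm_nonneg u) hu 2) (pow_le_pow_left₀ (l2Norm_nonneg u') hu' 2)
      (sq_nonneg _) (sq_nonneg _)
  have hn4 : (n : ℝ) * (K * w.mu) ≤ n ^ 4 * (K ^ 17 * w.mu) := by
    gcongr
    · exact le_self_pow₀ h.one_le_n (by simp)
    · exact le_self_pow₀ h.one_le (by simp)
  calc ∑ i, (w.z i * d.1 i ^ 2 / w.x i + w.x i * d.2.2 i ^ 2 / w.z i)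
      ≤ 6 * (w.x ⬝ᵥ w.z + Fintype.card (Fin n) * (K * w.mu)) + 8 * (K / w.mu) *
          (∑ i, w.z i ^ 2 * v.1 i ^ 2 + ∑ i, w.x i ^ 2 * v.2.2 i ^ 2)
          - 4 * ((d - v).1 ⬝ᵥ (d - v).2.2) :=
        sum_scaled_le_of_compl hw.x_pos hw.z_pos hμ (hd.σ_pos h).le (by linarith [hd.σ_le h])
          (h.mu_le_mul hw.toIsIterate) hd.compl
    _ ≤ 6 * (n * w.mu + n * (K * w.mu)) + 8 * (K / w.mu) *
          ((K * n) ^ 2 * (24 * K ^ 7 * n * w.mu) ^ 2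
            + (K * n) ^ 2 * (24 * K ^ 7 * n * w.mu) ^ 2) - 4 * 0 := by
        rw [h.dotProduct_eq, Fintype.card_fin]
        gcongr
        · exact hprod hw.z_le hvx
        · exact hprod hw.x_le hvz
    _ = 6 * (n * w.mu + n * (K * w.mu)) + 9216 * K ^ 17 * n ^ 4 * w.mu := by
        field_simp
        ring
    _ ≤ 9300 * K ^ 17 * n ^ 4 * w.mu := by
        have hnμ := mul_le_mul_of_nonneg_right h.one_le (mul_nonneg (n.cast_nonneg) hμ.le)
        have hpos : 0 ≤ n ^ 4 * (K ^ 17 * w.mu) := by positivity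
        linarith

lemma scaled_le (hw : I.IsBoundedIterate K a w) (i : Fin n) :
    w.z i * d.1 i ^ 2 / w.x i + w.x i * d.2.2 i ^ 2 / w.z i ≤ 9300 * K ^ 17 * n ^ 4 * w.mu :=
  (Finset.single_le_sum (f := fun i => w.z i * d.1 i ^ 2 / w.x i + w.x i * d.2.2 i ^ 2 / w.z i)
    (fun i _ => by have := hw.x_pos i; have := hw.z_pos i; positivity)
    (Finset.mem_univ i)).trans (hd.sum_scaled_le h hw)

lemma abs_le_mul_and_abs_le_mul (hw : I.IsBoundedIterate K a w) (i : Fin n) :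
    |d.1 i| ≤ 9300 * K ^ 17 * n ^ 2 * w.x i ∧ |d.2.2 i| ≤ 9300 * K ^ 17 * n ^ 2 * w.z i := by
  have hx := hw.x_pos i
  have hz := hw.z_pos i
  have hK := h.pos
  have hμ := h.mu_le_mul hw.toIsIterate i
  have hle := hd.scaled_le h hw i
  have hcb : 9300 * K ^ 17 * n ^ 4 * K ≤ (9300 * K ^ 17 * n ^ 2) ^ 2 := by
    have hpow := pow_mul_le_pow_mul h.one_le (by positivity : 0 ≤ (n : ℝ) ^ 4) (i := 18) (j := 34)
      (by simp)
    have hpos : 0 ≤ K ^ 34 * (n : ℝ) ^ 4 := by positivity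
    linarith
  constructor
  · exact abs_le_mul_of_scaled_le hx hz (by positivity) hμ
      ((le_add_of_nonneg_right (by positivity)).trans hle) (by positivity) hcb
  · exact abs_le_mul_of_scaled_le hz hx (by positivity) (mul_comm (w.x i) _ ▸ hμ)
      ((le_add_of_nonneg_left (by positivity)).trans hle) (by positivity) hcb

lemma l2Norm_skew_le (hw : I.IsBoundedIterate K a w) :
    l2Norm (skew d) ≤ 46508 * K ^ 21 * n ^ 3 := by
  have hK := h.pos
  have hle {u v : Fin n → ℝ} (hu : ∀ i, |u i| ≤ 9300 * K ^ 17 * n ^ 2 * v i)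
      (hv : l2Norm v ≤ K * n) : l2Norm u ≤ 9300 * K ^ 18 * n ^ 3 := by
    have hC : 0 ≤ 9300 * K ^ 17 * (n : ℝ) ^ 2 := by positivity
    calc l2Norm u ≤ 9300 * K ^ 17 * n ^ 2 * l2Norm v :=
          l2Norm_le_mul_l2Norm hC fun i =>
            (hu i).trans (mul_le_mul_of_nonneg_left (le_abs_self _) hC)
      _ ≤ 9300 * K ^ 17 * n ^ 2 * (K * n) := mul_le_mul_of_nonneg_left hv hC
      _ = 9300 * K ^ 18 * n ^ 3 := by ring
  have hx := hle (fun i => (hd.abs_le_mul_and_abs_le_mul h hw i).1) hw.x_le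
  have hz := hle (fun i => (hd.abs_le_mul_and_abs_le_mul h hw i).2) hw.z_le
  have hμ := hw.mu_le.trans h.mu0_le
  have hR : l2Norm (I.P.kkt d + w.mu • skew d) ≤ 8 * K ^ 6 * n ^ 3 := by
    refine (hd.l2Norm_kkt_add_le h hw).trans ?_
    calc 8 * K ^ 4 * n * w.mu ≤ 8 * K ^ 4 * n ^ 3 * K ^ 2 := by
          have := hw.mu_pos
          gcongr
          exact le_self_pow₀ h.one_le_n three_ne_zero
      _ = 8 * K ^ 6 * n ^ 3 := by ring
  have hy : l2Norm d.2.1 ≤ K * (8 * K ^ 6 * n ^ 3 + (K + K ^ 2) * (9300 * K ^ 18 * n ^ 3)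
      + 9300 * K ^ 18 * n ^ 3) := by
    refine (h.l2Norm_dual_le_add_smul d w.mu).trans ?_
    rw [abs_of_pos hw.mu_pos]
    have := l2Norm_nonneg d.1
    gcongr
  have hpow {i : ℕ} (hi : i ≤ 21) :=
    pow_mul_le_pow_mul h.one_le (pow_nonneg (n.cast_nonneg (α := ℝ)) 3) hi
  linarith [PrimalDual.l2Norm_skew_le d, pow_nonneg (n.cast_nonneg (α := ℝ)) 3,
    hpow (i := 0) (by simp), hpow (i := 7) (by simp), hpow (i := 18) (by simp),
    hpow (i := 19) (by simp), hpow (i := 20) (by simp)]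

lemma isBoundedDirection (hw : I.IsBoundedIterate K a w) :
    IsBoundedDirection (46508 * K ^ 21) w d := by
  have hK := h.pos
  have hμ := hw.mu_pos
  have hconst : 9300 * K ^ 17 ≤ 46508 * K ^ 21 :=
    mul_le_mul (by norm_num) (pow_le_pow_right₀ h.one_le (by simp)) (by positivity) (by simp)
  have hn4 : 9300 * K ^ 17 * n ^ 4 * w.mu ≤ 46508 * K ^ 21 * n ^ 4 * w.mu := by gcongr
  have hmul (i : Fin n) := abs_mul_le_scaled (hw.x_pos i) (hw.z_pos i) (p := d.1 i) (q := d.2.2 i)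
  refine ⟨fun i => ?_, fun i => ?_, fun i => ?_, ?_, hd.l2Norm_skew_le h hw⟩
  · have := hw.x_pos i
    exact (hd.abs_le_mul_and_abs_le_mul h hw i).1.trans (by gcongr)
  · have := hw.z_pos i
    exact (hd.abs_le_mul_and_abs_le_mul h hw i).2.trans (by gcongr)
  · exact (hmul i).trans ((hd.scaled_le h hw i).trans hn4)
  · calc |d.1 ⬝ᵥ d.2.2| ≤ ∑ i, |d.1 i * d.2.2 i| := Finset.abs_sum_le_sum_abs _ _
      _ ≤ _ := Finset.sum_le_sum fun i _ => hmul i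
      _ ≤ _ := (hd.sum_scaled_le h hw).trans hn4

end IsNewtonDirection

end Instance

end DirectionBounds

section ShortSteps

open PrimalDual

variable {n m : ℕ} {K K' σ α t t' : ℝ} {I : Instance n m} {w e : Triple n m}
  {a r : Fin m ⊕ Fin n → ℝ}

lemma Triple.mu_pos (hn : 0 < n) (hx : ∀ i, 0 < w.x i) (hz : ∀ i, 0 < w.z i) : 0 < w.mu :=
  div_pos (Finset.sum_pos (fun i _ => mul_pos (hx i) (hz i)) ⟨⟨0, hn⟩, Finset.mem_univ _⟩)
    (Nat.cast_pos.2 hn)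

namespace Instance

lemma IsBoundedIterate.mono (hw : I.IsBoundedIterate K a w) (hK : K ≤ K') :
    I.IsBoundedIterate K' a w where
  toIsIterate := hw.toIsIterate
  x_le := hw.x_le.trans (mul_le_mul_of_nonneg_right hK n.cast_nonneg)
  z_le := hw.z_le.trans (mul_le_mul_of_nonneg_right hK n.cast_nonneg)
  gap_le := hw.gap_le.trans (mul_le_mul_of_nonneg_right hK n.cast_nonneg)

lemma Bounded.within_mono (h : I.Bounded K) (hr : I.Within t r) (ht : t ≤ t') : I.Within t' r :=
  ⟨hr.1.trans (mul_le_mul_of_nonneg_left ht h.CN_pos.le),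
    hr.2.trans (mul_le_mul_of_nonneg_left ht (mul_nonneg h.γA_pos.le h.ρ_pos.le))⟩

namespace Bounded

variable (h : I.Bounded K) (hle : 60 * K ^ 12 * n ^ 4 * α ≤ 1)

include h hle

lemma pow_mul_pow_mul_le_one (hα : 0 < α) {i j : ℕ} (hi : i ≤ 12) (hj : j ≤ 4) :
    60 * (K ^ i * (n ^ j * α)) ≤ 1 := by
  have hK : K ^ i * (n ^ j * α) ≤ K ^ 12 * (n ^ 4 * α) :=
    (pow_mul_le_pow_mul h.one_le (by positivity) hi).trans <| mul_le_mul_of_nonneg_left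
      (pow_mul_le_pow_mul h.one_le_n hα.le hj) (pow_nonneg h.pos.le 12)
  linarith

lemma pow_mul_le_σmin : 60 * (K ^ 11 * (n ^ 4 * α)) ≤ I.par.σmin := by
  refine le_of_mul_le_mul_left ?_ h.pos
  linarith [h.one_le_mul_σmin]

lemma pow_mul_le_σmin_mul :
    60 * (K ^ 10 * (n ^ 4 * α)) ≤ I.par.σmin * (1 - I.par.γμ) := by
  refine le_of_mul_le_mul_left ?_ (pow_pos h.pos 2)
  linarith [one_le_mul_of_one_le_of_one_le h.one_le_mul_σmin h.one_le_mul_one_sub_γμ]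

end Bounded

lemma Bounded.abs_dotProduct_div_le (h : I.Bounded K) (hb : IsBoundedDirection K w e.vec) :
    |e.x ⬝ᵥ e.z / n| ≤ K * n ^ 3 * w.mu := by
  rw [abs_div, Nat.abs_cast, div_le_iff₀ (Nat.cast_pos.2 h.n_pos)]
  exact hb.abs_dotProduct_le.trans_eq (by ring)

lemma Bounded.abs_dotProduct_div_le_pow_four (h : I.Bounded K)
    (hb : IsBoundedDirection K w e.vec) (hμ : 0 ≤ w.mu) :
    |e.x ⬝ᵥ e.z / n| ≤ K * n ^ 4 * w.mu := by
  have := h.pos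
  refine (h.abs_dotProduct_div_le hb).trans ?_
  gcongr
  · exact h.one_le_n
  · simp

lemma add_mul_pos {x p b α : ℝ} (hx : 0 < x) (hα : 0 ≤ α) (hp : |p| ≤ b * x) (hb : α * b < 1) :
    0 < x + α * p := by
  linarith [mul_le_mul_of_nonneg_left (neg_le_of_abs_le hp) hα, mul_lt_mul_of_pos_right hb hx]

lemma Bounded.move_pos (h : I.Bounded K) (hw : I.IsIterate a w)
    (hb : IsBoundedDirection K w e.vec) (hα : 0 < α) (hle : 60 * K ^ 12 * n ^ 4 * α ≤ 1)
    (i : Fin n) : 0 < (w.move α e).x i ∧ 0 < (w.move α e).z i := by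
  have hlt : α * (K * n ^ 2) < 1 := by
    linarith [h.pow_mul_pow_mul_le_one hle hα (i := 1) (j := 2) (by simp) (by simp)]
  exact ⟨add_mul_pos (hw.x_pos i) hα.le (hb.abs_fst_le i) hlt,
    add_mul_pos (hw.z_pos i) hα.le (hb.abs_snd_snd_le i) hlt⟩

/-- The terms of second order in the stepsize `α` by which the deviation at `w + α e` differs from
linear interpolation, if `ε` is the second-order term of the duality measure. -/
noncomputable def remainder (I : Instance n m) (a : Fin m ⊕ Fin n → ℝ) (w e : Triple n m)
    (σ α ε : ℝ) : Fin m ⊕ Fin n → ℝ :=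
  ε • (skew w.vec - a) - (ε / I.mu0) • I.rbar + (α * (ε - α * ((1 - σ) * w.mu))) • skew e.vec

lemma l2Norm_remainder_le (h : I.Bounded K) (hw : I.IsBoundedIterate K a w)
    (hb : IsBoundedDirection K w e.vec) (hσ : 0 ≤ σ) (hσ1 : σ ≤ 1) (hα : 0 < α)
    (hle : 60 * K ^ 12 * n ^ 4 * α ≤ 1) {ε : ℝ} (hε : |ε| ≤ α ^ 2 * (K * n ^ 3 * w.mu)) :
    l2Norm (remainder I a w e σ α ε) ≤ 8 * K ^ 5 * n ^ 4 * α ^ 2 * w.mu := by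
  have hK := h.pos
  have hμ := hw.mu_pos
  have hgap : l2Norm (ε • (skew w.vec - a)) ≤ K ^ 2 * (n ^ 4 * α ^ 2 * w.mu) := by
    rw [l2Norm_smul]
    exact (mul_le_mul hε hw.gap_le (l2Norm_nonneg _) (by positivity)).trans_eq (by ring)
  have hrbar : l2Norm ((ε / I.mu0) • I.rbar) ≤ 5 * (K ^ 5 * (n ^ 4 * α ^ 2 * w.mu)) := by
    have hdiv : |ε / I.mu0| ≤ α ^ 2 * (K * n ^ 3) * (K ^ 2 * w.mu) := by
      rw [abs_div, abs_of_pos h.mu0_pos]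
      calc |ε| / I.mu0 ≤ α ^ 2 * (K * n ^ 3 * w.mu) / I.mu0 :=
            div_le_div_of_nonneg_right hε h.mu0_pos.le
        _ = α ^ 2 * (K * n ^ 3) * (w.mu / I.mu0) := by ring
        _ ≤ _ := mul_le_mul_of_nonneg_left (h.div_mu0_le hw.toIsIterate) (by positivity)
    rw [l2Norm_smul]
    exact (mul_le_mul hdiv h.rbar_le (l2Norm_nonneg _) (by positivity)).trans_eq (by ring)
  have hprox : l2Norm ((α * (ε - α * ((1 - σ) * w.mu))) • skew e.vec)
      ≤ 2 * (K * (n ^ 3 * α ^ 2 * w.mu)) := by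
    have hcoeff : |ε - α * ((1 - σ) * w.mu)| ≤ 2 * (α * w.mu) := by
      have hn3 := h.pow_mul_pow_mul_le_one hle hα (i := 1) (j := 3) (by simp) (by simp)
      have hαμ := mul_pos hα hμ
      rw [abs_le] at hε ⊢
      constructor <;> linarith [mul_le_mul_of_nonneg_right hn3 hαμ.le, mul_nonneg hσ hαμ.le,
        mul_le_mul_of_nonneg_right hσ1 hαμ.le]
    rw [l2Norm_smul, abs_mul, abs_of_pos hα]
    exact (mul_le_mul (mul_le_mul_of_nonneg_left hcoeff hα.le) hb.skew_le (l2Norm_nonneg _)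
      (by positivity)).trans_eq (by ring)
  have hn : K * (n ^ 3 * α ^ 2 * w.mu) ≤ K * (n ^ 4 * α ^ 2 * w.mu) := by
    gcongr
    · exact h.one_le_n
    · simp
  have hpow {i : ℕ} (hi : i ≤ 5) :=
    pow_mul_le_pow_mul h.one_le (by positivity : 0 ≤ n ^ 4 * α ^ 2 * w.mu) hi
  rw [remainder]
  linarith [l2Norm_add_le (ε • (skew w.vec - a) - (ε / I.mu0) • I.rbar)
      ((α * (ε - α * ((1 - σ) * w.mu))) • skew e.vec),
    l2Norm_sub_le (ε • (skew w.vec - a)) ((ε / I.mu0) • I.rbar),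
    hpow (i := 1) (by simp), hpow (i := 2) (by simp)]

lemma within_remainder (h : I.Bounded K) (hw : I.IsBoundedIterate K a w)
    (hb : IsBoundedDirection K w e.vec) (hσ : 0 ≤ σ) (hσ1 : σ ≤ 1) (hα : 0 < α)
    (hle : 60 * K ^ 12 * n ^ 4 * α ≤ 1) :
    I.Within (24 * (K ^ 11 * (n ^ 4 * α ^ 2 * (w.mu / I.mu0))))
      (remainder I a w e σ α (α ^ 2 * (e.x ⬝ᵥ e.z / n))) := by
  have hθ := hw.div_mu0_pos h
  have hε : |α ^ 2 * (e.x ⬝ᵥ e.z / n)| ≤ α ^ 2 * (K * n ^ 3 * w.mu) := by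
    rw [abs_mul, abs_of_nonneg (sq_nonneg α)]
    exact mul_le_mul_of_nonneg_left (h.abs_dotProduct_div_le hb) (sq_nonneg α)
  have hK := h.pos
  refine h.within_of_l2Norm_le ?_
  calc 3 * K ^ 4 * l2Norm (remainder I a w e σ α _)
      ≤ 3 * K ^ 4 * (8 * K ^ 5 * n ^ 4 * α ^ 2 * w.mu) :=
        mul_le_mul_of_nonneg_left (l2Norm_remainder_le h hw hb hσ hσ1 hα hle hε) (by positivity)
    _ = 24 * K ^ 9 * n ^ 4 * α ^ 2 * (w.mu / I.mu0 * I.mu0) := by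
        rw [div_mul_cancel₀ _ h.mu0_pos.ne']
        ring
    _ ≤ 24 * K ^ 9 * n ^ 4 * α ^ 2 * (w.mu / I.mu0 * K ^ 2) :=
        mul_le_mul_of_nonneg_left (mul_le_mul_of_nonneg_left h.mu0_le hθ.le) (by positivity)
    _ = 24 * (K ^ 11 * (n ^ 4 * α ^ 2 * (w.mu / I.mu0))) := by ring

namespace IsNewtonDirection

variable (hd : I.IsNewtonDirection a w σ r e.vec)

include hd

lemma move_mul (α : ℝ) (i : Fin n) : (w.move α e).x i * (w.move α e).z i
    = (1 - α) * (w.x i * w.z i) + α * (σ * w.mu) + α ^ 2 * (e.x i * e.z i) := by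
  have hi : w.z i * e.x i + w.x i * e.z i = σ * w.mu - w.x i * w.z i := hd.compl i
  simp only [Triple.move, Pi.add_apply, Pi.smul_apply, smul_eq_mul]
  linear_combination α * hi

lemma mu_move (hn : 0 < n) (α : ℝ) :
    (w.move α e).mu = (1 - α) * w.mu + α * (σ * w.mu) + α ^ 2 * (e.x ⬝ᵥ e.z / n) := by
  have hn' : (n : ℝ) ≠ 0 := Nat.cast_ne_zero.2 hn.ne'
  have hsum : (w.move α e).x ⬝ᵥ (w.move α e).z
      = (1 - α) * (w.x ⬝ᵥ w.z) + n * (α * (σ * w.mu)) + α ^ 2 * (e.x ⬝ᵥ e.z) := by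
    simp only [dotProduct, hd.move_mul, Finset.sum_add_distrib, ← Finset.mul_sum, Finset.sum_const,
      Finset.card_univ, Fintype.card_fin, nsmul_eq_mul, mul_left_comm]
  rw [Triple.mu, hsum, add_div, add_div, mul_div_cancel_left₀ _ hn', mul_div_assoc, mul_div_assoc,
    ← Triple.mu]

lemma deviation_move (α ε : ℝ) :
    I.deviation ((1 - α) * w.mu + α * (σ * w.mu) + ε) a (w.move α e).vec
      = (1 - α) • I.deviation w.mu a w.vec + α • r
        + remainder I a w e σ α ε := by
  have hmove : (w.move α e).vec = w.vec + α • e.vec := rfl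
  rw [hmove, deviation, map_add, map_smul, map_add, map_smul, eq_sub_of_add_eq hd.kkt_add,
    deviation, deviation, remainder, add_div, add_div, mul_div_assoc, mul_div_assoc, mul_div_assoc]
  module

variable (h : I.Bounded K) (hw : I.IsBoundedIterate K a w) (hb : IsBoundedDirection K w e.vec)
  (hα : 0 < α) (hle : 60 * K ^ 12 * n ^ 4 * α ≤ 1)

include h hw hb hα hle

lemma mu_move_le : (w.move α e).mu ≤ (1 - 0.01 * α) * w.mu := by
  have hE := (le_abs_self _).trans (h.abs_dotProduct_div_le hb)
  have hn3 := h.pow_mul_pow_mul_le_one hle hα (i := 1) (j := 3) (by simp) (by simp)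
  have hαμ := mul_pos hα hw.mu_pos
  rw [hd.mu_move h.n_pos]
  linarith [mul_le_mul_of_nonneg_left hE (sq_nonneg α), mul_le_mul_of_nonneg_right hn3 hαμ.le,
    mul_le_mul_of_nonneg_right (hd.σ_le h) hαμ.le]

lemma central_move (i : Fin n) :
    I.par.γμ * (w.move α e).mu ≤ (w.move α e).x i * (w.move α e).z i := by
  have hK := h.pos
  have hμ := hw.mu_pos
  have hα1 := h.pow_mul_pow_mul_le_one hle hα (i := 0) (j := 0) (by simp) (by simp)
  have hγ1 := h.γμ_lt_one.le
  have hE : I.par.γμ * (α ^ 2 * (e.x ⬝ᵥ e.z / n)) ≤ α ^ 2 * (K * n ^ 4 * w.mu) :=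
    calc I.par.γμ * (α ^ 2 * (e.x ⬝ᵥ e.z / n)) ≤ I.par.γμ * (α ^ 2 * (K * n ^ 4 * w.mu)) := by
          have := (le_abs_self _).trans (h.abs_dotProduct_div_le_pow_four hb hμ.le)
          have := h.γμ_pos
          gcongr
      _ ≤ α ^ 2 * (K * n ^ 4 * w.mu) := mul_le_of_le_one_left (by positivity) hγ1
  have hprod : α ^ 2 * -(K * n ^ 4 * w.mu) ≤ α ^ 2 * (e.x i * e.z i) :=
    mul_le_mul_of_nonneg_left (neg_le_of_abs_le (hb.abs_mul_le i)) (sq_nonneg α)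
  have hσ : 2 * (K * n ^ 4 * α) ≤ σ * (1 - I.par.γμ) := by
    linarith [h.pow_mul_le_σmin_mul hle, mul_le_mul_of_nonneg_right hd.σmin_le (sub_nonneg.2 hγ1),
      pow_mul_le_pow_mul h.one_le (by positivity : 0 ≤ n ^ 4 * α) (i := 1) (j := 10) (by simp),
      (by positivity : 0 ≤ K ^ 10 * (n ^ 4 * α))]
  have hcentral := mul_le_mul_of_nonneg_left (hw.central i) (by linarith : 0 ≤ 1 - α)
  rw [hd.mu_move h.n_pos, hd.move_mul]
  linarith [mul_le_mul_of_nonneg_right hσ (mul_pos hα hμ).le]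

lemma within_move :
    I.Within ((w.move α e).mu / I.mu0) (I.deviation (w.move α e).mu a (w.move α e).vec) := by
  have hθ := hw.div_mu0_pos h
  have hαθ := (mul_pos hα hθ).le
  have hα1 : 0 ≤ 1 - α := by
    linarith [h.pow_mul_pow_mul_le_one hle hα (i := 0) (j := 0) (by simp) (by simp)]
  have hlevel : -(K ^ 11 * (n ^ 4 * α ^ 2 * (w.mu / I.mu0)))
      ≤ α ^ 2 * (e.x ⬝ᵥ e.z / n) / I.mu0 := by
    rw [← mul_div_assoc, ← mul_div_assoc, ← neg_div]
    refine div_le_div_of_nonneg_right ?_ h.mu0_pos.le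
    have hE := mul_le_mul_of_nonneg_left
      (neg_le_of_abs_le (h.abs_dotProduct_div_le_pow_four hb hw.mu_pos.le)) (sq_nonneg α)
    have hpos : 0 ≤ n ^ 4 * α ^ 2 * w.mu := by
      have := hw.mu_pos
      positivity
    linarith [pow_mul_le_pow_mul h.one_le hpos (i := 1) (j := 11) (by simp)]
  rw [hd.mu_move h.n_pos, hd.deviation_move]
  refine h.within_mono (((hw.within.smul h.surjective hα1).add h.surjective
    (hd.within.smul h.surjective hα.le)).add h.surjective
    (within_remainder h hw hb (hd.σ_pos h).le (by linarith [hd.σ_le h]) hα hle)) ?_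
  rw [add_div, add_div, mul_div_assoc, mul_div_assoc, mul_div_assoc]
  linarith [mul_le_mul_of_nonneg_right (h.pow_mul_le_σmin hle) hαθ,
    mul_le_mul_of_nonneg_right hd.σmin_le hαθ, mul_nonneg h.σmin_pos.le hαθ]

lemma isIterate_move : I.IsIterate a (w.move α e) where
  mu_pos := Triple.mu_pos h.n_pos (fun i => (h.move_pos hw.toIsIterate hb hα hle i).1)
    fun i => (h.move_pos hw.toIsIterate hb hα hle i).2
  mu_le := by
    refine (hd.mu_move_le h hw hb hα hle).trans
      ((mul_le_of_le_one_left hw.mu_pos.le ?_).trans hw.mu_le)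
    linarith
  within := hd.within_move h hw hb hα hle
  x_pos i := (h.move_pos hw.toIsIterate hb hα hle i).1
  z_pos i := (h.move_pos hw.toIsIterate hb hα hle i).2
  central := hd.central_move h hw hb hα hle

end IsNewtonDirection

end Instance

end ShortSteps

section Run

variable {n m N : ℕ} {K α t : ℝ} {I : Instance n m} {s s' : State n m} {d : Triple n m}

/-- The stepsize constant `κ` that belongs to data bounded by `K`. Iterates are then bounded by
`230 K⁸ n`, and directions are bounded with the constant `46508 (230 K⁸)²¹`. -/
noncomputable def stepConstant (K : ℝ) : ℝ := (60 * (46508 * (230 * K ^ 8) ^ 21) ^ 12)⁻¹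

lemma stepConstant_pos (hK : 0 < K) : 0 < stepConstant K := by
  rw [stepConstant]
  positivity

namespace Instance

/-- The loop invariant of the algorithm: the current point lies in its neighborhood, and the
estimates come from a point that lies in the neighborhood anchored at this point itself. -/
structure Invariant (I : Instance n m) (s : State n m) : Prop where
  isIterate : I.IsIterate (anchor s.ζ s.lam) s.pt
  exists_anchor : ∃ w : Triple n m, I.IsIterate (anchor w.x w.y) w ∧ s.ζ = w.x ∧ s.lam = w.y

namespace Invariant

lemma isBoundedIterate (hs : I.Invariant s) (h : I.Bounded K) :
    I.IsBoundedIterate (230 * K ^ 8) (anchor s.ζ s.lam) s.pt := by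
  obtain ⟨w, hw, hζ, hlam⟩ := hs.exists_anchor
  refine hs.isIterate.isBoundedIterate h ?_
  rw [hζ, hlam]
  exact hw.l2Norm_anchor_le h

lemma mem_admissible (hs : I.Invariant s) (h : I.Bounded K) (hd : I.IsDirection s d)
    (hα : 0 < α) (hle : α ≤ stepConstant K / n ^ 4) : α ∈ I.admissible s d := by
  obtain ⟨σ, r, hd⟩ := hd.exists_isNewtonDirection
  set K₁ := 230 * K ^ 8 with hK₁
  set K₂ := 46508 * K₁ ^ 21 with hK₂
  have hKK₁ : K ≤ K₁ := by linarith [le_self_pow₀ h.one_le (n := 8) (by simp), h.pos]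
  have h₁ := h.mono hKK₁
  have hK₁₂ : K₁ ≤ K₂ := by linarith [le_self_pow₀ h₁.one_le (n := 21) (by simp), h₁.pos]
  have h₂ := h₁.mono hK₁₂
  have hb := hd.isBoundedDirection h₁ (hs.isBoundedIterate h)
  have hw := (hs.isBoundedIterate h).mono hK₁₂
  have hsmall : 60 * K₂ ^ 12 * n ^ 4 * α ≤ 1 := by
    have hK₂' := h₂.pos
    rw [stepConstant, le_div_iff₀ (pow_pos (Nat.cast_pos.2 h.n_pos) 4),
      ← one_div, le_div_iff₀ (by positivity)] at hle
    linarith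
  have hα1 := h₂.pow_mul_pow_mul_le_one hsmall hα (i := 0) (j := 0) (by simp) (by simp)
  have hmove := (isIterate_anchor_iff h).1 (hd.isIterate_move h₂ hw hb hα hsmall)
  exact ⟨hα, by linarith, hd.mu_move_le h₂ hw hb hα hsmall, hmove.2⟩

lemma step (hs : I.Invariant s) (h : I.Bounded K) (hstep : I.Step s s') : I.Invariant s' := by
  obtain ⟨d, α, -, ⟨⟨hα, -, hmu, hmem⟩, -⟩, hpt, hupdate, hkeep⟩ := hstep
  rw [← hpt] at hmu hmem
  have hpos := Triple.mu_pos h.n_pos (fun i => (hmem.2 i).1) fun i => (hmem.2 i).2.1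
  have hle : s'.pt.mu ≤ I.mu0 := hmu.trans <|
    (mul_le_of_le_one_left hs.isIterate.mu_pos.le (by linarith)).trans hs.isIterate.mu_le
  have hw := (isIterate_anchor_iff h).2 ⟨⟨hpos, hle⟩, hmem⟩
  by_cases htest : I.UpdateTest s'.pt
  · obtain ⟨hζ, hlam⟩ := hupdate htest
    have hself : I.IsIterate (anchor s'.pt.x s'.pt.y) s'.pt :=
      { hw with within := updateTest_iff.1 htest }
    exact ⟨by rwa [hζ, hlam], s'.pt, hself, hζ, hlam⟩
  · obtain ⟨hζ, hlam⟩ := hkeep htest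
    exact ⟨by rwa [hζ, hlam], by simpa only [hζ, hlam] using hs.exists_anchor⟩

end Invariant

variable {s : ℕ → State n m}

lemma Run.invariant (hrun : I.Run N s) (h : I.Bounded K) : ∀ k ≤ N, I.Invariant (s k) := by
  intro k hk
  induction k with
  | zero =>
    rw [hrun.1]
    exact ⟨isIterate_start h, I.start, isIterate_start h, rfl, rfl⟩
  | succ k ih => exact (ih (Nat.le_of_succ_le hk)).step h (hrun.2 k hk)

lemma Run.mu_le_exp_mul (hrun : I.Run N s) (hmu : ∀ k ≤ N, 0 ≤ (s k).pt.mu)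
    (ht : ∀ k ≤ N, ∀ d, I.IsDirection (s k) d → t ∈ I.admissible (s k) d) :
    ∀ k ≤ N, (s k).pt.mu ≤ Real.exp (-(0.01 * t * k)) * I.mu0 := by
  intro k hk
  induction k with
  | zero =>
    rw [hrun.1, Nat.cast_zero, mul_zero, neg_zero, Real.exp_zero, one_mul, mu0]
  | succ k ih =>
    have hk' := Nat.le_of_succ_le hk
    obtain ⟨d, α, hd, ⟨hα, hmax⟩, hpt, -⟩ := hrun.2 k hk
    have htα := hmax (ht k hk' d hd)
    have hfactor : 1 - 0.01 * α ≤ Real.exp (-(0.01 * t)) := by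
      linarith [Real.one_sub_le_exp_neg (0.01 * t)]
    calc (s (k + 1)).pt.mu ≤ (1 - 0.01 * α) * (s k).pt.mu := by rw [hpt]; exact hα.2.2.1
      _ ≤ Real.exp (-(0.01 * t)) * (s k).pt.mu := mul_le_mul_of_nonneg_right hfactor (hmu k hk')
      _ ≤ Real.exp (-(0.01 * t)) * (Real.exp (-(0.01 * t * k)) * I.mu0) :=
          mul_le_mul_of_nonneg_left (ih hk') (Real.exp_pos _).le
      _ = Real.exp (-(0.01 * t * (k + 1 : ℕ))) * I.mu0 := by
          rw [← mul_assoc, ← Real.exp_add]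
          push_cast
          ring_nf

end Instance

end Run

section IterationBound

variable {n : ℕ} {κ ε C ω : ℝ}

lemma exp_neg_mul_le {L : ℝ} (hε : 0 < ε) (hC : 0 < C)
    (hL : (1 + ω) * Real.log (1 / ε) + Real.log C ≤ L) : Real.exp (-L) * (C / ε ^ ω) ≤ ε := by
  have hexp : C / ε ^ ω = Real.exp (Real.log C - Real.log ε * ω) := by
    rw [Real.exp_sub, Real.exp_log hC, Real.rpow_def_of_pos hε]
  rw [hexp, ← Real.exp_add]
  refine (Real.exp_le_exp.2 ?_).trans_eq (Real.exp_log hε)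
  rw [one_div, Real.log_inv] at hL
  linarith

lemma exp_neg_mul_le_of_iterationBound_le (hn : 0 < n) (hκ : 0 < κ) (hε : 0 < ε) (hC : 0 < C)
    {x : ℝ} (hx : iterationBound κ C ω n ε ≤ x) :
    Real.exp (-(0.01 * (κ / n ^ 4) * x)) * (C / ε ^ ω) ≤ ε := by
  have hn4 : 0 < (n : ℝ) ^ 4 := pow_pos (Nat.cast_pos.2 hn) 4
  refine exp_neg_mul_le hε hC ?_
  rw [iterationBound, div_mul_eq_mul_div, div_le_iff₀ (by positivity)] at hx
  rw [mul_div_assoc', div_mul_eq_mul_div, le_div_iff₀ hn4]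
  linarith

lemma isBigO_iterationBound (κ C ω : ℝ) :
    (fun p : ℕ × ℝ => iterationBound κ C ω p.1 p.2)
      =O[⊤ ×ˢ 𝓝[>] (0 : ℝ)] (fun p : ℕ × ℝ => (p.1 : ℝ) ^ 4 * Real.log (1 / p.2)) := by
  have hlog : Tendsto (fun ε : ℝ => Real.log (1 / ε)) (𝓝[>] 0) atTop := by
    simpa only [one_div, Function.comp_def] using
      Real.tendsto_log_atTop.comp (tendsto_inv_nhdsGT_zero (𝕜 := ℝ))
  have hsum : (fun ε : ℝ => (1 + ω) * Real.log (1 / ε) + Real.log C)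
      =O[𝓝[>] 0] fun ε => Real.log (1 / ε) :=
    ((isBigO_refl _ _).const_mul_left (1 + ω)).add
      (isLittleO_const_left.2 (.inr (tendsto_norm_atTop_atTop.comp hlog))).isBigO
  simpa only [iterationBound, div_eq_inv_mul, mul_assoc, Function.comp_def] using
    ((isBigO_refl (fun p : ℕ × ℝ => (p.1 : ℝ) ^ 4) _).const_mul_left (0.01 * κ)⁻¹).mul
      (hsum.comp_tendsto tendsto_snd)

end IterationBound

section ExistsBound

variable {n m : ℕ} {Cy Cstar Cmin Cmax CQ Cr K : ℝ}

lemma QP.RegularData.m_le {P : QP n m} (h : P.RegularData Cmin Cmax CQ Cr) : m ≤ n := by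
  simpa only [h.1, Fintype.card_fin] using P.A.rank_le_card_width

lemma QP.BoundedOptimalSolution.exists_solution {P : QP n m} (hQ : P.Q.PosSemidef)
    (h : P.BoundedOptimalSolution Cstar) : ∃ v : PrimalDual n m, P.kkt v = Sum.elim P.b P.c ∧
      (∀ i, (0 ≤ v.1 i ∧ v.1 i ≤ Cstar) ∧ 0 ≤ v.2.2 i ∧ v.2.2 i ≤ Cstar) ∧
      v.1 ⬝ᵥ v.2.2 = 0 ∧ ‖v.2.1‖ ≤ Cstar := by
  obtain ⟨x, y, z, hopt, hx, hy, hz⟩ := h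
  obtain ⟨⟨⟨hAx, hx0⟩, -⟩, ⟨hAy, hz0⟩, -⟩ := id hopt
  have hdual : -(P.Q *ᵥ x) + P.Aᵀ *ᵥ y + z = P.c := by
    rw [add_assoc, hAy, neg_add_cancel_left]
  have hle {u : Fin n → ℝ} (hu : ‖u‖ ≤ Cstar) (i : Fin n) : u i ≤ Cstar :=
    (le_abs_self _).trans ((norm_le_pi_norm u i).trans hu)
  exact ⟨(x, y, z), congrArg₂ Sum.elim hAx hdual,
    fun i => ⟨⟨hx0 i, hle hx i⟩, hz0 i, hle hz i⟩, hopt.complementary hQ, hy⟩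

lemma l2Norm_le_mul_of_norm_le {u : Fin m → ℝ} (hm : m ≤ n) (hK : 0 ≤ K) (hu : ‖u‖ ≤ K) :
    l2Norm u ≤ K * n :=
  l2Norm_le_mul_of_abs_le (by simpa using hm) hK fun i => (norm_le_pi_norm u i).trans hu

lemma QP.RegularData.exists_preimage {P : QP n m} (h : P.RegularData Cmin Cmax CQ Cr)
    (hCmin : 0 < Cmin) (b : Fin m → ℝ) :
    ∃ x, P.A *ᵥ x = b ∧ l2Norm x ≤ Cmin⁻¹ * l2Norm b := by
  have hrank : P.A.rank = Fintype.card (Fin m) := by rw [h.1, Fintype.card_fin]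
  obtain ⟨x, hx, hle⟩ := exists_mulVec_eq_of_le_singularValues hrank hCmin
    (fun i hi => (h.2.1 i (h.1 ▸ hi)).1) b
  exact ⟨x, hx, (le_inv_mul_iff₀ hCmin).2 hle⟩

lemma QP.RegularData.l2Norm_rhs_le {P : QP n m} (h : P.RegularData Cmin Cmax CQ Cr)
    (hK : 0 ≤ K) (hCr : 2 * Cr ≤ K) : l2Norm (Sum.elim P.b P.c) ≤ K * n := by
  have hK2 : 0 ≤ K / 2 := div_nonneg hK zero_le_two
  have hb := l2Norm_le_mul_of_norm_le h.m_le hK2 (h.2.2.2.2.trans (by linarith))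
  have hc := l2Norm_le_mul_of_norm_le le_rfl hK2 (h.2.2.2.1.trans (by linarith))
  linarith [l2Norm_sumElim_le P.b P.c]

lemma exists_bounded {par : Params} (hpar : par.Valid) (Cy Cstar Cmax CQ Cr : ℝ)
    (hCmin : 0 < Cmin) : ∃ K : ℝ, 1 ≤ K ∧ ∀ (n m : ℕ) (P : QP n m) (y0 : Fin m → ℝ), 0 < n →
      P.Q.PosSemidef → P.BoundedOptimalSolution Cstar → P.RegularData Cmin Cmax CQ Cr →
      ‖y0‖ ≤ Cy → (Instance.mk P par y0).Bounded K := by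
  obtain ⟨⟨hσ, -⟩, hCN, ⟨hγA, hγA1⟩, ⟨hγμ, hγμ1⟩, hρ⟩ := id hpar
  obtain ⟨K, hK⟩ := Finset.exists_le ({1, Cy, Cstar, Cmin⁻¹, Cmax, CQ, 2 * Cr, par.ρ, par.CN,
    par.ρ⁻¹, par.CN⁻¹, par.γA⁻¹, (1 - par.γA)⁻¹, par.γμ⁻¹, (1 - par.γμ)⁻¹, par.σmin⁻¹} : Finset ℝ)
  simp only [Finset.mem_insert, Finset.mem_singleton, forall_eq_or_imp, forall_eq] at hK
  obtain ⟨h1, hCy, hCstar, hCmin', hCmax, hCQ, hCr, hρK, hCNK, hρ', hCN', hγA', hγA1', hγμ',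
    hγμ1', hσ'⟩ := hK
  have hK0 : 0 ≤ K := zero_le_one.trans h1
  refine ⟨K, h1, fun n m P y0 hn hQ hopt hreg hy0 => ?_⟩
  obtain ⟨v, hv, hbox, hcompl, hy⟩ := hopt.exists_solution hQ
  exact {
    valid := hpar
    n_pos := hn
    m_le := hreg.m_le
    one_le := h1
    ρ_le := hρK
    CN_le := hCNK
    one_le_mul_ρ := (inv_le_iff_one_le_mul₀ hρ).1 hρ'
    one_le_mul_CN := (inv_le_iff_one_le_mul₀ hCN).1 hCN'
    one_le_mul_γA := (inv_le_iff_one_le_mul₀ hγA).1 hγA'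
    one_le_mul_one_sub_γA := (inv_le_iff_one_le_mul₀ (sub_pos.2 hγA1)).1 hγA1'
    one_le_mul_γμ := (inv_le_iff_one_le_mul₀ hγμ).1 hγμ'
    one_le_mul_one_sub_γμ := (inv_le_iff_one_le_mul₀ (sub_pos.2 hγμ1)).1 hγμ1'
    one_le_mul_σmin := (inv_le_iff_one_le_mul₀ hσ).1 hσ'
    Q_posSemidef := hQ
    Q_le := l2Norm_mulVec_le_of_posSemidef hQ hK0 fun t ht => (hreg.2.2.1 t ht).trans hCQ
    A_le := l2Norm_mulVec_le_of_singularValues_le hK0 fun i hi =>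
      (hreg.2.1 i (hreg.1 ▸ hi)).2.trans hCmax
    exists_preimage b := (hreg.exists_preimage hCmin b).imp fun _ hx =>
      ⟨hx.1, hx.2.trans (mul_le_mul_of_nonneg_right hCmin' (l2Norm_nonneg b))⟩
    rhs_le := hreg.l2Norm_rhs_le hK0 hCr
    y0_le := l2Norm_le_mul_of_norm_le hreg.m_le hK0 (hy0.trans hCy)
    exists_solution := ⟨v, hv, fun i => ⟨(hbox i).1.imp_right fun hx => hx.trans hCstar,
      (hbox i).2.imp_right fun hz => hz.trans hCstar⟩, hcompl,
      l2Norm_le_mul_of_norm_le hreg.m_le hK0 (hy.trans hCstar)⟩ }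

end ExistsBound

end IPPMM

theorem theorem3p4_general (par : IPPMM.Params) (hpar : par.Valid)
    (Cy Cstar Cmin Cmax CQ Cr : ℝ) (hCmin : 0 < Cmin) :
    ∃ κ : ℝ, 0 < κ ∧
      (∀ (n m : ℕ) (P : IPPMM.QP n m) (y0 : Fin m → ℝ), 0 < n →
        P.Q.PosSemidef → P.BoundedOptimalSolution Cstar → P.RegularData Cmin Cmax CQ Cr →
        ‖y0‖ ≤ Cy →
        ∀ (N : ℕ) (s : ℕ → IPPMM.State n m), (IPPMM.Instance.mk P par y0).Run N s →
          (∀ k ≤ N, ∀ d : IPPMM.Triple n m, (IPPMM.Instance.mk P par y0).IsDirection (s k) d →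
            ∀ α : ℝ, 0 < α → α ≤ κ / (n : ℝ) ^ 4 →
              α ∈ (IPPMM.Instance.mk P par y0).admissible (s k) d) ∧
          (∀ ε C ω : ℝ, 0 < ε → 0 < C → (IPPMM.Instance.mk P par y0).mu0 ≤ C / ε ^ ω →
            ∀ k ≤ N, IPPMM.iterationBound κ C ω n ε ≤ (k : ℝ) → (s k).pt.mu ≤ ε)) ∧
      (∀ C ω : ℝ, 0 < C →
        (fun p : ℕ × ℝ => IPPMM.iterationBound κ C ω p.1 p.2)
          =O[⊤ ×ˢ 𝓝[>] (0 : ℝ)] (fun p : ℕ × ℝ => (p.1 : ℝ) ^ 4 * Real.log (1 / p.2))) := by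
  obtain ⟨K, hK, hbounded⟩ := IPPMM.exists_bounded hpar Cy Cstar Cmax CQ Cr hCmin
  have hκ := IPPMM.stepConstant_pos (zero_lt_one.trans_le hK)
  refine ⟨IPPMM.stepConstant K, hκ, ?_, fun C ω _ => IPPMM.isBigO_iterationBound _ C ω⟩
  intro n m P y0 hn hQ hopt hreg hy0 N s hrun
  have h := hbounded n m P y0 hn hQ hopt hreg hy0
  have hinv := hrun.invariant h
  have hadm : ∀ k ≤ N, ∀ d, (IPPMM.Instance.mk P par y0).IsDirection (s k) d → ∀ α : ℝ, 0 < α →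
      α ≤ IPPMM.stepConstant K / (n : ℝ) ^ 4 →
        α ∈ (IPPMM.Instance.mk P par y0).admissible (s k) d :=
    fun k hk d hd α hα hle => (hinv k hk).mem_admissible h hd hα hle
  refine ⟨hadm, fun ε C ω hε hC hmu0 k hk hbound => ?_⟩
  have hdecay := hrun.mu_le_exp_mul (fun k hk => (hinv k hk).isIterate.mu_pos.le)
    (fun k hk d hd => hadm k hk d hd _ (by positivity) le_rfl) k hk
  exact hdecay.trans <| (mul_le_mul_of_nonneg_left hmu0 (Real.exp_pos _).le).trans
    (IPPMM.exp_neg_mul_le_of_iterationBound_le hn hκ hε hC hbound)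

theorem theorem3p4 (par : IPPMM.Params) (hpar : par.Valid)
    (Cy Cstar Cmin Cmax CQ Cr : ℝ) (hCy : 0 ≤ Cy) (hCstar : 0 ≤ Cstar) (hCmin : 0 < Cmin)
    (hCmax : 0 < Cmax) (hCQ : 0 < CQ) (hCr : 0 < Cr) :
    ∃ κ : ℝ, 0 < κ ∧
      (∀ (n m : ℕ) (P : IPPMM.QP n m) (y0 : Fin m → ℝ), 0 < n →
        P.SeparableConvex → P.BoundedOptimalSolution Cstar → P.RegularData Cmin Cmax CQ Cr →
        ‖y0‖ ≤ Cy →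
        ∀ (N : ℕ) (s : ℕ → IPPMM.State n m), (IPPMM.Instance.mk P par y0).Run N s →
          (∀ k ≤ N, ∀ d : IPPMM.Triple n m, (IPPMM.Instance.mk P par y0).IsDirection (s k) d →
            ∀ α : ℝ, 0 < α → α ≤ κ / (n : ℝ) ^ 4 →
              α ∈ (IPPMM.Instance.mk P par y0).admissible (s k) d) ∧
          (∀ ε C ω : ℝ, 0 < ε → ε < 1 → 0 < C → 0 < ω →
            (IPPMM.Instance.mk P par y0).mu0 ≤ C / ε ^ ω →
            ∀ k ≤ N, IPPMM.iterationBound κ C ω n ε ≤ (k : ℝ) → (s k).pt.mu ≤ ε)) ∧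
      (∀ C ω : ℝ, 0 < C → 0 < ω →
        (fun p : ℕ × ℝ => IPPMM.iterationBound κ C ω p.1 p.2)
          =O[⊤ ×ˢ 𝓝[>] (0 : ℝ)] (fun p : ℕ × ℝ => (p.1 : ℝ) ^ 4 * Real.log (1 / p.2))) := by
  obtain ⟨κ, hκ, hrun, hbound⟩ := theorem3p4_general par hpar Cy Cstar Cmin Cmax CQ Cr hCmin
  exact ⟨κ, hκ, fun n m P y0 hn hQ hopt hreg hy0 N s hs =>
    (hrun n m P y0 hn hQ.2 hopt hreg hy0 N s hs).imp_right
      fun h ε C ω hε _ hC _ => h ε C ω hε hC, fun C ω hC _ => hbound C ω hC⟩
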